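/- Let $K$ be an oriented virtual knot or link, that is, an equivalence class of oriented virtual link diagrams (immersions of one or several oriented circles in the plane whose only singularities are transverse double points, each marked as a classical crossing, with over/under information, or as a virtual crossing) under planar isotopy and the generalized Reidemeister moves: the classical moves (r1)–(r3), their purely virtual versions (v1)–(v3), and the mixed move (v4), in which an arc with two consecutive virtual crossings is moved across a classical crossing. The virtual crossing number $v(K)$ is the minimum, over all diagrams $D$ of $K$, of the number of virtual crossings of $D$. Given a diagram $D$ of $K$, the virtual knot group $VG_K$ is generated by the short arcs of $D$ (the arcs from one classical or virtual crossing to the next) together with two elements $s$ and $q$. Its relations are $[s,q]=1$ and two relations for each crossing. At a classical crossing let $o,u$ be the incoming and $o',u'$ the outgoing over- and under-arcs; at a virtual crossing, drawn with both strands directed upwards, let $l\to r'$ be the strand going from the lower left to the upper right, and $r\to l'$ the strand going from the lower right to the upper left. The relations are $$o'=s\,o\,s^{-1},\quad u'=o\,u\,s\,o^{-1}s^{-1}\qquad\text{(positive crossing)},$$ $$o'=s^{-1}o\,s,\quad u'=s^{-1}o^{-1}s\,u\,o\qquad\text{(negative crossing)},$$ $$r'=q\,l\,q^{-1},\quad l'=q^{-1}r\,q\qquad\text{(virtual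 crossing)}.$$ Let $\mathcal L=\mathbb Z[s^{\pm1},t^{\pm1},q^{\pm1}]$ be the group ring of $\mathbb Z^3$ (written multiplicatively, with basis $s,t,q$), and let $\alpha\colon VG_K\to\mathbb Z^3$ be the homomorphism with $s\mapsto s$, $q\mapsto q$ that maps every arc to $t$. For a finite presentation of $VG_K$ with $g$ generators $x_j$ and relators $r_i$, let $M$ be the matrix over $\mathcal L$ obtained by applying $\alpha$ to the Fox derivatives $\partial r_i/\partial x_j$. The $0$-th elementary ideal $\mathcal E_0\subset\mathcal L$ is generated by all $(g-1)\times(g-1)$ minors of $M$. The virtual Alexander polynomial $H_K(s,t,q)\in\mathcal L$ is a generator of the smallest principal ideal of $\mathcal L$ that contains $\mathcal E_0$ (the greatest common divisor of these minors); it is well defined up to multiplication by units $\pm s^it^jq^k$ and does not depend on the diagram or on the presentation. The $q$-width of a nonzero element of $\mathcal L$ is the difference between its maximal and its minimal exponent of $q$; the $q$-width of $0$ is $0$. **Theorem.** For every virtual knot or link $K$, $$q\text{-}\operatorname{width} H_K(s,t,q)\;\le\; 2\,v(K).$$ -/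

import Mathlib

/-! ### Oriented virtual link diagrams -/

namespace VirtualKnot

/-- The type of a double point: a positive or negative classical crossing, or a virtual crossing. -/
inductive Kind
  | pos
  | neg
  | virt
  deriving DecidableEq

/-- Exchange positive and negative crossings; virtual crossings stay virtual. -/
def Kind.mirror : Kind → Kind
  | .pos => .neg
  | .neg => .pos
  | .virt => .virt

/-- The vertices of an oriented diagram whose arcs are labelled by `α`.

* `X k l r l' r'` is a double point of type `k`. Drawn with both strands going upwards, the incoming
  arcs are `l` (bottom left) and `r` (bottom right), the outgoing arcs are `l'` (top left) and `r'`
  (top right). The two strands are `l → r'` and `r → l'`. In a positive crossing `l → r'` is the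
  over-strand, in a negative crossing `r → l'` is the over-strand.
* `pt a b` is a marked point on a strand, at which the arc `a` ends and the arc `b` begins. Marked
  points carry no information; they allow a circle without double points to be recorded. -/
inductive Node (α : Type)
  | X (k : Kind) (l r l' r' : α)
  | pt (a b : α)
  deriving DecidableEq

namespace Node

variable {α β : Type}

/-- Relabel the arcs. -/
def map (f : α → β) : Node α → Node β
  | X k l r l' r' => X k (f l) (f r) (f l') (f r')
  | pt a b => pt (f a) (f b)

/-- The arcs that end at the vertex. -/
def ins : Node α → List α
  | X _ l r _ _ => [l, r]
  | pt a _ => [a]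

/-- The arcs that begin at the vertex. -/
def outs : Node α → List α
  | X _ _ _ l' r' => [l', r']
  | pt _ b => [b]

/-- Is the vertex a virtual crossing? -/
def isVirtual : Node α → Bool
  | X .virt _ _ _ _ => true
  | _ => false

/-- The sectors of the plane at a vertex. Each sector is given by the two sides of arcs which bound
it; `(e, true)` is the left side and `(e, false)` the right side of the oriented arc `e`. -/
def sectors : Node α → List ((α × Bool) × (α × Bool))
  | X _ l r l' r' =>
      [((l, true), (l', true)),     -- left sector
       ((r, false), (r', false)),   -- right sector
       ((l, false), (r, true)),     -- bottom sector
       ((l', false), (r', true))]   -- top sector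
  | pt a b => [((a, true), (b, true)), ((a, false), (b, false))]

/-- The classical crossing of sign `ε` with over-strand `a.1 → a.2` and under-strand `b.1 → b.2`. -/
def overUnder (ε : ℤˣ) (a b : α × α) : Node α :=
  if ε = 1 then X .pos a.1 b.1 b.2 a.2 else X .neg b.1 a.1 a.2 b.2

/-- The virtual crossing of the strands `a.1 → a.2` and `b.1 → b.2`, where `b` crosses `a` from right
to left if `ε = 1`, and from left to right if `ε = -1`. -/
def virtually (ε : ℤˣ) (a b : α × α) : Node α :=
  if ε = 1 then X .virt a.1 b.1 b.2 a.2 else X .virt b.1 a.1 a.2 b.2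

end Node

/-- An oriented virtual link diagram with at least one component, as a combinatorial map: the arcs
are labelled by `Fin n`, every arc begins at exactly one vertex and ends at exactly one vertex, and
the rotation system given by the vertices is planar: the numbers of vertices, edges, faces and
connected components satisfy `V - E + F = 2 C`. Faces are the classes of sides of arcs under the
relation "adjacent in a sector at a vertex". -/
structure Diagram where
  n : ℕ
  nodes : List (Node (Fin n))
  nonempty : nodes ≠ []
  ins_perm : (nodes.flatMap Node.ins).Perm (List.finRange n)
  outs_perm : (nodes.flatMap Node.outs).Perm (List.finRange n)
  planar :
    (nodes.length : ℤ) - n +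
      Nat.card (Quot fun x y : Fin n × Bool => ∃ N ∈ nodes, (x, y) ∈ N.sectors) =
    2 * Nat.card (Quot fun x y : Fin n => ∃ N ∈ nodes, x ∈ N.ins ++ N.outs ∧ y ∈ N.ins ++ N.outs)

/-- The number `v(D)` of virtual crossings of a diagram. -/
def Diagram.virtualCrossings (D : Diagram) : ℕ := D.nodes.countP Node.isVirtual

/-! ### Generalized Reidemeister moves -/

section Moves

variable {α : Type}

/-- The first (`o = 1`) or second (`o = -1`) of the two crossings on the strand `a 0 → a 1 → a 2`. -/
def seg (o : ℤˣ) (a : Fin 3 → α) : α × α := if o = 1 then (a 0, a 1) else (a 1, a 2)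

/-- Three strands `a`, `b`, `c` in general position, forming a triangle. The signs `oa`, `ob`, `oc`
are `1` when `a` meets `b` before `c`, `b` meets `c` before `a`, and `c` meets `a` before `b`,
respectively; `δ = 1` when the corners `ab`, `ac`, `bc` of the triangle are in counterclockwise order.
These signs determine the directions in which the strands cross. Moving one strand across the
crossing of the other two replaces `(oa, ob, oc)` by `(-oa, -ob, -oc)` and keeps `δ`. -/
def triangle (ab ac bc : ℤˣ → α × α → α × α → Node α) (δ oa ob oc : ℤˣ) (a b c : Fin 3 → α) :
    List (Node α) :=
  [ab (-(oa * ob * δ)) (seg oa a) (seg (-ob) b),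
   ac (oa * oc * δ) (seg (-oa) a) (seg oc c),
   bc (-(ob * oc * δ)) (seg ob b) (seg (-oc) c)]

/-- The local moves, as replacements of parts of diagrams with the same ends. -/
inductive LocalMove : List (Node α) → List (Node α) → Prop
  -- planar isotopy: renaming of arcs, and insertion of marked points
  | rename : LocalMove [] []
  | pt_pt (a b c : α) : LocalMove [.pt a b, .pt b c] [.pt a c]
  | pt_inl (k : Kind) (e l r l' r' : α) : LocalMove [.pt e l, .X k l r l' r'] [.X k e r l' r']
  | pt_inr (k : Kind) (e l r l' r' : α) : LocalMove [.pt e r, .X k l r l' r'] [.X k l e l' r']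
  | pt_outl (k : Kind) (e l r l' r' : α) : LocalMove [.pt l' e, .X k l r l' r'] [.X k l r e r']
  | pt_outr (k : Kind) (e l r l' r' : α) : LocalMove [.pt r' e, .X k l r l' r'] [.X k l r l' e]
  -- (r1) and (v1): a curl to the left or to the right
  | curl_left (k : Kind) (a b x : α) : LocalMove [.X k x a x b] [.pt a b]
  | curl_right (k : Kind) (a b x : α) : LocalMove [.X k a x b x] [.pt a b]
  -- (r2) and (v2): two parallel strands, and two antiparallel strands in both positions
  | bigon (k : Kind) (a b x y c d : α) :
      LocalMove [.X k a b x y, .X k.mirror x y c d] [.pt a c, .pt b d]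
  | bigon_left (k : Kind) (a b x y c d : α) :
      LocalMove [.X k y a x d, .X k.mirror x b y c] [.pt a c, .pt b d]
  | bigon_right (k : Kind) (a b x y c d : α) :
      LocalMove [.X k a y d x, .X k.mirror b x c y] [.pt a c, .pt b d]
  -- (r3): the strand `a` is over `b` and `c`, and `b` is over `c`
  | r3 (δ oa ob oc : ℤˣ) (a b c : Fin 3 → α) :
      LocalMove (triangle .overUnder .overUnder .overUnder δ oa ob oc a b c)
        (triangle .overUnder .overUnder .overUnder δ (-oa) (-ob) (-oc) a b c)
  -- (v3): all three crossings are virtual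
  | v3 (δ oa ob oc : ℤˣ) (a b c : Fin 3 → α) :
      LocalMove (triangle .virtually .virtually .virtually δ oa ob oc a b c)
        (triangle .virtually .virtually .virtually δ (-oa) (-ob) (-oc) a b c)
  -- (v4): the strand `c` has virtual crossings with `a` and `b`, and `a` is over `b`
  | v4 (δ oa ob oc : ℤˣ) (a b c : Fin 3 → α) :
      LocalMove (triangle .overUnder .virtually .virtually δ oa ob oc a b c)
        (triangle .overUnder .virtually .virtually δ (-oa) (-ob) (-oc) a b c)

end Moves

/-- `D'` arises from `D` by one local move: after naming the arcs, `D` consists of the left side and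
`D'` of the right side of the move, together with the same remaining vertices. -/
def Diagram.Step (D D' : Diagram) : Prop :=
  ∃ (f : Fin D.n ↪ ℕ) (g : Fin D'.n ↪ ℕ) (A B rest : List (Node ℕ)), LocalMove A B ∧
    (D.nodes.map (Node.map f)).Perm (A ++ rest) ∧ (D'.nodes.map (Node.map g)).Perm (B ++ rest)

/-- Equivalence of virtual link diagrams: the equivalence relation generated by the moves. -/
def Diagram.equivalence : Setoid Diagram := Relation.EqvGen.setoid Diagram.Step

end VirtualKnot

/-- Oriented virtual knots and links. -/
def VirtualLink : Type := Quotient VirtualKnot.Diagram.equivalence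

namespace VirtualKnot

/-- The diagram `D` represents the virtual link `K`. -/
def Diagram.Represents (D : Diagram) (K : VirtualLink) : Prop :=
  Quotient.mk Diagram.equivalence D = K

end VirtualKnot

/-- The virtual crossing number `v(K)`: the minimum of `v(D)` over all diagrams `D` of `K`. -/
noncomputable def VirtualLink.virtualCrossingNumber (K : VirtualLink) : ℕ :=
  sInf {m | ∃ D : VirtualKnot.Diagram, D.Represents K ∧ D.virtualCrossings = m}

namespace VirtualKnot

/-! ### The virtual knot group -/

/-- The generators of the virtual knot group: the arcs and the auxiliary generators `s`, `q`. -/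
inductive Gen (n : ℕ)
  | arc (i : Fin n)
  | s
  | q
  deriving DecidableEq

section Relators

variable {n : ℕ}

/-- The relators at a vertex: for a positive crossing with over-strand `l → r'`,
`r' = s l s⁻¹` and `l' = l r s l⁻¹ s⁻¹`; for a negative crossing with over-strand `r → l'`,
`l' = s⁻¹ r s` and `r' = s⁻¹ r⁻¹ s l r`; for a virtual crossing `r' = q l q⁻¹` and
`l' = q⁻¹ r q`; at a marked point the two arcs agree. -/
def Node.relators (N : Node (Fin n)) : List (FreeGroup (Gen n)) :=
  let x : Fin n → FreeGroup (Gen n) := fun i => .of (.arc i)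
  let s : FreeGroup (Gen n) := .of .s
  let q : FreeGroup (Gen n) := .of .q
  match N with
  | .X .pos l r l' r' =>
      [(x r')⁻¹ * (s * x l * s⁻¹), (x l')⁻¹ * (x l * x r * s * (x l)⁻¹ * s⁻¹)]
  | .X .neg l r l' r' =>
      [(x l')⁻¹ * (s⁻¹ * x r * s), (x r')⁻¹ * (s⁻¹ * (x r)⁻¹ * s * x l * x r)]
  | .X .virt l r l' r' =>
      [(x r')⁻¹ * (q * x l * q⁻¹), (x l')⁻¹ * (q⁻¹ * x r * q)]
  | .pt a b => [(x b)⁻¹ * x a]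

/-- The relators of the virtual knot group: those of the vertices, and the commutator of `s`, `q`. -/
def Diagram.relators (D : Diagram) : Set (FreeGroup (Gen D.n)) :=
  {w | ∃ N ∈ D.nodes, w ∈ N.relators} ∪
    {.of .s * .of .q * (.of .s)⁻¹ * (.of .q)⁻¹}

end Relators

/-- The virtual knot group `VG` of a diagram. -/
abbrev Diagram.VG (D : Diagram) : Type := PresentedGroup D.relators

/-- The degrees in `ℤ³` of the generators: `s ↦ (1,0,0)`, arcs `↦ t = (0,1,0)`, `q ↦ (0,0,1)`. -/
def Gen.degree {n : ℕ} : Gen n → Multiplicative (ℤ × ℤ × ℤ)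
  | .arc _ => .ofAdd (0, 1, 0)
  | .s => .ofAdd (1, 0, 0)
  | .q => .ofAdd (0, 0, 1)

theorem Diagram.degree_relators (D : Diagram) :
    ∀ w ∈ D.relators, FreeGroup.lift Gen.degree w = 1 := by
  rintro w (⟨N, -, hw⟩ | hw)
  · rcases N with ⟨k, l, r, l', r'⟩ | ⟨a, b⟩
    · rcases k <;> simp only [Node.relators, List.mem_cons, List.not_mem_nil, or_false] at hw <;>
        rcases hw with rfl | rfl <;> simp [Gen.degree, mul_comm, mul_left_comm]
    · simp only [Node.relators, List.mem_cons, List.not_mem_nil, or_false] at hw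
      subst hw
      simp [Gen.degree]
  · rw [Set.mem_singleton_iff] at hw
    subst hw
    simp [mul_comm]

/-- The homomorphism `VG → ℤ³` with `s ↦ s`, `q ↦ q`, and every arc generator `↦ t`. -/
def Diagram.degree (D : Diagram) : D.VG →* Multiplicative (ℤ × ℤ × ℤ) :=
  PresentedGroup.toGroup D.degree_relators

/-! ### Fox calculus and elementary ideals -/

section Fox

variable {α : Type} [DecidableEq α]

/-- Left multiplication by group elements on the additive group of `ℤ[F]`. -/
noncomputable def foxAction (α : Type) :
    FreeGroup α →* MulAut (Multiplicative (MonoidAlgebra ℤ (FreeGroup α))) where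
  toFun w :=
    { toFun := fun z => .ofAdd (MonoidAlgebra.of ℤ _ w * z.toAdd)
      invFun := fun z => .ofAdd (MonoidAlgebra.of ℤ _ w⁻¹ * z.toAdd)
      left_inv := fun z => by
        simp only [toAdd_ofAdd, ← mul_assoc, ← map_mul, inv_mul_cancel, map_one, one_mul, ofAdd_toAdd]
      right_inv := fun z => by
        simp only [toAdd_ofAdd, ← mul_assoc, ← map_mul, mul_inv_cancel, map_one, one_mul, ofAdd_toAdd]
      map_mul' := fun y z => by
        simp only [toAdd_mul, mul_add, ofAdd_add] }
  map_one' := by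
    ext z
    simp [← MonoidAlgebra.one_def]
  map_mul' u v := by
    refine MulEquiv.ext fun z => ?_
    change Multiplicative.ofAdd (MonoidAlgebra.of ℤ _ (u * v) * z.toAdd) =
      Multiplicative.ofAdd (MonoidAlgebra.of ℤ _ u * (MonoidAlgebra.of ℤ _ v * z.toAdd))
    rw [(MonoidAlgebra.of ℤ (FreeGroup α)).map_mul, mul_assoc]

/-- The homomorphism `w ↦ (∂w/∂x_j, w)` to the semidirect product of `ℤ[F]` and `F`. -/
noncomputable def foxHom (j : α) :
    FreeGroup α →* Multiplicative (MonoidAlgebra ℤ (FreeGroup α)) ⋊[foxAction α] FreeGroup α :=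
  FreeGroup.lift fun i => ⟨.ofAdd (if i = j then 1 else 0), .of i⟩

/-- The Fox derivative `∂w/∂x_j` in the group ring of the free group; it is determined by
`foxDeriv_of` and `foxDeriv_mul`. -/
noncomputable def foxDeriv (j : α) (w : FreeGroup α) : MonoidAlgebra ℤ (FreeGroup α) :=
  (foxHom j w).left.toAdd

theorem foxHom_right (j : α) (w : FreeGroup α) : (foxHom j w).right = w := by
  have h : (SemidirectProduct.rightHom.comp (foxHom j)) = MonoidHom.id (FreeGroup α) := by
    ext i
    simp [foxHom]
  exact DFunLike.congr_fun h w

theorem foxDeriv_of (j i : α) : foxDeriv j (FreeGroup.of i) = if i = j then 1 else 0 := by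
  simp [foxDeriv, foxHom]

theorem foxDeriv_mul (j : α) (u v : FreeGroup α) :
    foxDeriv j (u * v) = foxDeriv j u + MonoidAlgebra.of ℤ _ u * foxDeriv j v := by
  rw [foxDeriv, map_mul, SemidirectProduct.mul_left, foxHom_right]
  rfl

end Fox

/-- The ring `ℤ[s^{±1}, t^{±1}, q^{±1}]`; the monomial `s^i t^j q^k` is `single (i, j, k) 1`. -/
abbrev Laurent : Type := AddMonoidAlgebra ℤ (ℤ × ℤ × ℤ)

/-- The ideal generated by all `k × k` minors of a matrix (the zero ideal if the matrix has fewer than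
`k` rows or columns, the unit ideal if `k = 0`). -/
def minorIdeal {R : Type} [CommRing R] {m n : ℕ} (M : Matrix (Fin m) (Fin n) R) (k : ℕ) : Ideal R :=
  Ideal.span {d | ∃ (r : Fin k → Fin m) (c : Fin k → Fin n), d = (M.submatrix r c).det}

/-- A finite presentation of the virtual knot group of a diagram, with `g` generators and `m`
relators. -/
structure Presentation (D : Diagram) where
  g : ℕ
  m : ℕ
  rel : Fin m → FreeGroup (Fin g)
  iso : PresentedGroup (Set.range rel) ≃* D.VG

namespace Presentation

variable {D : Diagram}

/-- The ring homomorphism from the group ring of the free group to the Laurent polynomials that is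
induced by the composition of the quotient map to `VG` with `VG → ℤ³`. -/
noncomputable def eval (P : Presentation D) : MonoidAlgebra ℤ (FreeGroup (Fin P.g)) →+* Laurent :=
  (MonoidAlgebra.lift ℤ Laurent (FreeGroup (Fin P.g))
    ((AddMonoidAlgebra.of ℤ (ℤ × ℤ × ℤ)).comp
      (D.degree.comp (P.iso.toMonoidHom.comp (PresentedGroup.mk (Set.range P.rel)))))).toRingHom

/-- The matrix of Fox derivatives of the relators, evaluated in the ring of Laurent polynomials. -/
noncomputable def foxMatrix (P : Presentation D) : Matrix (Fin P.m) (Fin P.g) Laurent :=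
  Matrix.of fun i j => P.eval (foxDeriv j (P.rel i))

/-- The `0`-th elementary ideal: it is generated by the minors of the Fox matrix whose size is one
less than the number of generators of the group. -/
noncomputable def elementaryIdeal (P : Presentation D) : Ideal Laurent :=
  minorIdeal P.foxMatrix (P.g - 1)

end Presentation

/-- The `q`-width: the difference between the maximal and the minimal exponent of `q`, which is the
largest difference of two exponents of `q`; it is `0` for the zero polynomial. -/
noncomputable def qWidth (f : Laurent) : ℕ :=
  f.coeff.support.sup fun a => f.coeff.support.sup fun b => (a.2.2 - b.2.2).toNat

end VirtualKnot

/-- `H` is (a representative, up to units, of) the virtual Alexander polynomial of `K`: it generates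
the smallest principal ideal containing the `0`-th elementary ideal of the virtual knot group of `K`,
where any diagram of `K` and any finite presentation of the group may be used. -/
def VirtualLink.IsVirtualAlexanderPolynomial (K : VirtualLink) (H : VirtualKnot.Laurent) : Prop :=
  ∃ (D : VirtualKnot.Diagram) (P : VirtualKnot.Presentation D), D.Represents K ∧
    IsLeast {I : Ideal VirtualKnot.Laurent | I.IsPrincipal ∧ P.elementaryIdeal ≤ I} (Ideal.span {H})

-- Choose a diagram of the link with the fewest virtual crossings and, say, `n` arcs. Its group has
-- `n + 2` generators (arcs, `s`, `q`) and `n + 1` relators: one for each arc, attached to the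
-- vertex where the arc begins, and the commutator. Deleting the column of `s` from the Fox matrix
-- leaves a square matrix, whose determinant `e` lies in the elementary ideal. In this matrix the
-- rows of classical crossings and marked points are free of `q`. Each of the two rows of a virtual
-- crossing uses only two adjacent exponents of `q`. The commutator row has the single entry `s -
-- 1`, in the column of `q`; the entry `1 - q` of width one stood in the deleted column. Hence `e`
-- has `q`-width at most `2 v` (`det_mem_window`, `exists_foxWidth_flatMap`).
--
-- If `e ≠ 0`, then `H` divides `e`, and divisors of a nonzero Laurent polynomial over `ℤ` have no
-- larger width (`qWidth_le_of_dvd`). If `e = 0`, a linear dependence of the truncated rows extends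
-- to the column of `s` by the fundamental formula of Fox calculus, because `s - 1` is not a zero
-- divisor. Then all maximal minors vanish and `H = 0`. Both cases are prepared in
-- `Diagram.exists_minor`.
--
-- Since `H` may be computed from any diagram and any presentation, invariance is needed as well. It
-- has two halves. The elementary ideal depends only on the group with its map to `ℤ³`: it is a
-- Fitting ideal of the quotient of the free module by the relation module
-- (`fittingIdeal_relationModule`). The group with this map is unchanged by the moves
-- (`Diagram.Step.exists_mulEquiv`). Here homomorphisms out of the group are read as colorings of
-- the arcs, and each move transports colorings in a unique way.

namespace VirtualKnot

-- Fitting ideals of a submodule, without coordinates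

section FittingIdeal

variable {R F F' : Type*} [CommRing R] [AddCommGroup F] [Module R F] [AddCommGroup F'] [Module R F']

/-- Multilinearity lets the arguments be moved from `S` to its span one slot at a time; `t` is the
set of slots already moved. -/
theorem multilinearMap_mem_of_mem_span {ι N : Type*} [Fintype ι] [DecidableEq ι] [AddCommGroup N]
    [Module R N] (f : MultilinearMap R (fun _ : ι => F) N) {S : Set F} {P : Submodule R N}
    (h : ∀ v : ι → F, (∀ i, v i ∈ S) → f v ∈ P) (v : ι → F)
    (hv : ∀ i, v i ∈ Submodule.span R S) : f v ∈ P := by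
  suffices H : ∀ (t : Finset ι) (v : ι → F), (∀ i ∈ t, v i ∈ Submodule.span R S) →
      (∀ i ∉ t, v i ∈ S) → f v ∈ P from
    H Finset.univ v (fun i _ => hv i) fun i hi => absurd (Finset.mem_univ i) hi
  intro t
  induction t using Finset.induction_on with
  | empty => exact fun v _ hv => h v fun i => hv i (Finset.notMem_empty i)
  | insert a t ha ih =>
    intro v hv hv'
    have key : ∀ x ∈ Submodule.span R S, f (Function.update v a x) ∈ P := by
      intro x hx
      induction hx using Submodule.span_induction with
      | mem x hx =>
        refine ih _ (fun i hi => ?_) fun i hi => ?_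
        · have : i ≠ a := fun e => ha (e ▸ hi)
          simpa [this] using hv i (Finset.mem_insert_of_mem hi)
        · by_cases e : i = a
          · subst e; simpa using hx
          · simpa [e] using hv' i (by simp [e, hi])
      | zero => simp [f.map_update_zero]
      | add x y _ _ hx hy => rw [f.map_update_add]; exact P.add_mem hx hy
      | smul c x _ hx => rw [f.map_update_smul]; exact P.smul_mem c hx
    simpa using key (v a) (hv a (Finset.mem_insert_self a t))

/-- The ideal generated by the `k × k` minors `det (φ j (κ i))`, where the `κ i` are elements of `K`
and the `φ j` are linear functionals. For free `F` of rank `n`, this is the Fitting ideal of `F ⧸ K`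
of index `n - k`. -/
def fittingIdeal (K : Submodule R F) (k : ℕ) : Ideal R :=
  Ideal.span {d | ∃ (κ : Fin k → F) (φ : Fin k → Module.Dual R F), (∀ i, κ i ∈ K) ∧
    d = (Matrix.of fun i j => φ j (κ i)).det}

theorem det_mem_fittingIdeal {K : Submodule R F} {k : ℕ} {κ : Fin k → F} (hκ : ∀ i, κ i ∈ K)
    (φ : Fin k → Module.Dual R F) : (Matrix.of fun i j => φ j (κ i)).det ∈ fittingIdeal K k :=
  Ideal.subset_span ⟨κ, φ, hκ, rfl⟩

/-- The determinant is multilinear in the vectors and, after transposition, in the functionals. So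
minors of a generating set of rows and of coordinate functionals suffice. -/
theorem det_mem_of_mem_span {k : ℕ} {S : Set F} {Φ : Set (Module.Dual R F)} {I : Ideal R}
    (h : ∀ (κ : Fin k → F) (φ : Fin k → Module.Dual R F), (∀ i, κ i ∈ S) → (∀ i, φ i ∈ Φ) →
      (Matrix.of fun i j => φ j (κ i)).det ∈ I)
    (κ : Fin k → F) (φ : Fin k → Module.Dual R F) (hκ : ∀ i, κ i ∈ Submodule.span R S)
    (hφ : ∀ i, φ i ∈ Submodule.span R Φ) : (Matrix.of fun i j => φ j (κ i)).det ∈ I := by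
  refine multilinearMap_mem_of_mem_span (P := I)
    ((Matrix.detRowAlternating (R := R) (n := Fin k)).toMultilinearMap.compLinearMap
      fun _ => LinearMap.pi φ) (S := S) (fun κ hκ => ?_) κ hκ
  have := multilinearMap_mem_of_mem_span (P := I)
    ((Matrix.detRowAlternating (R := R) (n := Fin k)).toMultilinearMap.compLinearMap
      fun _ => LinearMap.pi fun i => Module.Dual.eval R F (κ i)) (S := Φ) (fun φ hφ => ?_) φ hφ
  · change (Matrix.of fun j i => φ j (κ i)).det ∈ I at this
    rw [← Matrix.det_transpose] at this
    exact this
  · have := h κ φ hκ hφ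
    rw [← Matrix.det_transpose] at this
    exact this

theorem fittingIdeal_span_le {k : ℕ} {S : Set F} {Φ : Set (Module.Dual R F)} {I : Ideal R}
    (hΦ : Submodule.span R Φ = ⊤)
    (h : ∀ (κ : Fin k → F) (φ : Fin k → Module.Dual R F), (∀ i, κ i ∈ S) → (∀ i, φ i ∈ Φ) →
      (Matrix.of fun i j => φ j (κ i)).det ∈ I) :
    fittingIdeal (Submodule.span R S) k ≤ I := by
  refine Ideal.span_le.2 ?_
  rintro _ ⟨κ, φ, hκ, rfl⟩
  exact det_mem_of_mem_span h κ φ hκ fun i => hΦ ▸ Submodule.mem_top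

theorem fittingIdeal_map_le (K : Submodule R F) (e : F →ₗ[R] F') (k : ℕ) :
    fittingIdeal (K.map e) k ≤ fittingIdeal K k := by
  refine Ideal.span_le.2 ?_
  rintro _ ⟨κ, φ, hκ, rfl⟩
  choose κ' hκ' e' using hκ
  simp only [← e']
  exact det_mem_fittingIdeal hκ' fun j => (φ j).comp e

theorem fittingIdeal_map_equiv (K : Submodule R F) (e : F ≃ₗ[R] F') (k : ℕ) :
    fittingIdeal (K.map (e : F →ₗ[R] F')) k = fittingIdeal K k := by
  refine le_antisymm (fittingIdeal_map_le K _ k) ?_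
  have h := fittingIdeal_map_le (K.map (e : F →ₗ[R] F')) (e.symm : F' →ₗ[R] F) k
  rwa [← Submodule.map_comp, LinearEquiv.symm_comp, Submodule.map_id] at h

/-- Functionals on `F × R` are spanned by those pulled back from `F` and by the last coordinate. A
minor that uses the last coordinate twice vanishes. Otherwise some column can be expanded so that
only pulled-back functionals remain in the cofactors. -/
theorem fittingIdeal_succ_le (K : Submodule R F) (k : ℕ) :
    fittingIdeal (K.prod (⊤ : Submodule R R)) (k + 1) ≤ fittingIdeal K k := by
  have hΦ : Submodule.span R (Set.range (fun ψ : Module.Dual R F => ψ.comp (LinearMap.fst R F R)) ∪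
      {LinearMap.snd R F R}) = ⊤ := by
    refine eq_top_iff.2 fun φ _ => ?_
    have : φ = (φ.comp (LinearMap.inl R F R)).comp (LinearMap.fst R F R) +
        φ (0, 1) • LinearMap.snd R F R := by
      refine LinearMap.ext fun ⟨x, r⟩ => ?_
      have : ((x, r) : F × R) = (x, 0) + r • (0, 1) := by simp
      rw [this, map_add, map_smul]
      simp [mul_comm]
    rw [this]
    refine Submodule.add_mem _ (Submodule.subset_span (Or.inl ⟨_, rfl⟩))
      (Submodule.smul_mem _ _ (Submodule.subset_span (Or.inr rfl)))
  rw [← Submodule.span_eq (K.prod (⊤ : Submodule R R))]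
  refine fittingIdeal_span_le hΦ fun κ φ hκ hφ => ?_
  by_cases h2 : ∃ i j, i ≠ j ∧ φ i = LinearMap.snd R F R ∧ φ j = LinearMap.snd R F R
  · obtain ⟨i, j, hij, hi, hj⟩ := h2
    rw [Matrix.det_zero_of_column_eq hij (by simp [hi, hj])]
    exact Ideal.zero_mem _
  -- The column `j` is the one equal to the last coordinate, or any column if there is none.
  obtain ⟨j, hj⟩ : ∃ j, ∀ i, i ≠ j → φ i ≠ LinearMap.snd R F R := by
    by_contra! H
    obtain ⟨i, -, hi⟩ := H 0
    obtain ⟨i', h', hi'⟩ := H i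
    exact h2 ⟨i', i, h', hi', hi⟩
  have hψ : ∀ i : Fin k, ∃ ψ : Module.Dual R F, ψ.comp (LinearMap.fst R F R) = φ (j.succAbove i) :=
    fun i => (hφ _).resolve_right (hj _ (Fin.succAbove_ne j i))
  choose ψ hψ using hψ
  rw [Matrix.det_succ_column _ j]
  refine Ideal.sum_mem _ fun i _ => Ideal.mul_mem_left _ _ ?_
  have := det_mem_fittingIdeal (K := K) (κ := fun a => (κ (i.succAbove a)).1)
    (fun a => (hκ _).1) ψ
  convert this using 2
  ext a b
  simp [← hψ]

theorem le_fittingIdeal_succ (K : Submodule R F) (k : ℕ) :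
    fittingIdeal K k ≤ fittingIdeal (K.prod (⊤ : Submodule R R)) (k + 1) := by
  refine Ideal.span_le.2 ?_
  rintro _ ⟨κ, φ, hκ, rfl⟩
  -- Border the given minor by the row `(0, 1)` and the column of the last coordinate: the new top
  -- row is `(1, 0, …, 0)`.
  have := det_mem_fittingIdeal (K := K.prod (⊤ : Submodule R R))
    (κ := Fin.cons (0, 1) fun i => (κ i, 0)) (fun i => by
      refine Fin.cases ?_ (fun i => ?_) i
      · simp
      · simpa using hκ i)
    (Fin.cons (LinearMap.snd R F R) fun i => (φ i).comp (LinearMap.fst R F R))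
  rw [Matrix.det_succ_row_zero, Fin.sum_univ_succ] at this
  simp only [Matrix.of_apply, Fin.cons_zero, Fin.cons_succ, LinearMap.snd_apply,
    LinearMap.comp_apply, LinearMap.fst_apply, map_zero, mul_zero, zero_mul, Finset.sum_const_zero,
    add_zero, Fin.val_zero, pow_zero, one_mul] at this
  change _ ∈ fittingIdeal (K.prod (⊤ : Submodule R R)) (k + 1)
  convert this using 2
  ext a b
  simp

theorem fittingIdeal_prod_fin (n : ℕ) : ∀ (K : Submodule R F) (k : ℕ),
    fittingIdeal (K.prod (⊤ : Submodule R (Fin n → R))) (k + n) = fittingIdeal K k := by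
  induction n with
  | zero =>
    intro K k
    have := fittingIdeal_map_equiv (K.prod (⊤ : Submodule R (Fin 0 → R)))
      (LinearEquiv.prodUnique (R := R) (M := F) (M₂ := Fin 0 → R)) k
    rw [Nat.add_zero, ← this]
    congr 1
    ext x
    simp
  | succ n ih =>
    intro K k
    rw [← ih, le_antisymm_iff.2
      ⟨le_fittingIdeal_succ (K.prod (⊤ : Submodule R (Fin n → R))) (k + n),
      fittingIdeal_succ_le _ _⟩]
    let e : (F × (Fin (n + 1) → R)) ≃ₗ[R] (F × (Fin n → R)) × R :=
      (LinearEquiv.prodCongr (LinearEquiv.refl R F)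
        ((Fin.consLinearEquiv R fun _ => R).symm.trans (LinearEquiv.prodComm R R _))).trans
        (LinearEquiv.prodAssoc R F (Fin n → R) R).symm
    rw [← fittingIdeal_map_equiv _ e, Nat.add_assoc]
    congr 1
    ext ⟨⟨x, y⟩, z⟩
    rw [Submodule.mem_map_equiv]
    simp [e]

/-- Adding free generators together with relations that kill them leaves the quotient module alone
and raises the size of the minors by their number. -/
theorem fittingIdeal_prod {X : Type*} [Fintype X] (K : Submodule R F) (k : ℕ) :
    fittingIdeal (K.prod (⊤ : Submodule R (X → R))) (k + Fintype.card X) = fittingIdeal K k := by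
  rw [← fittingIdeal_prod_fin (Fintype.card X) K k, ← fittingIdeal_map_equiv _
    (LinearEquiv.prodCongr (LinearEquiv.refl R F) (LinearEquiv.funCongrLeft R R
      (Fintype.equivFin X).symm))]
  congr 1
  ext ⟨x, y⟩
  rw [Submodule.mem_map_equiv]
  simp

/-- Fitting ideals depend only on the quotient module: the hypotheses say that `T` and `T'` induce
mutually inverse maps between `(X → R) ⧸ K` and `(Y → R) ⧸ K'`. -/
theorem fittingIdeal_eq_of_inverse_mod {X Y : Type*} [Fintype X] [Fintype Y] [Nonempty X]
    [Nonempty Y] {K : Submodule R (X → R)} {K' : Submodule R (Y → R)}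
    (T : (X → R) →ₗ[R] (Y → R)) (T' : (Y → R) →ₗ[R] (X → R))
    (hT : ∀ x ∈ K, T x ∈ K') (hT' : ∀ y ∈ K', T' y ∈ K)
    (h : ∀ x, T' (T x) - x ∈ K) (h' : ∀ y, T (T' y) - y ∈ K') :
    fittingIdeal K (Fintype.card X - 1) = fittingIdeal K' (Fintype.card Y - 1) := by
  rw [← fittingIdeal_prod (X := Y), ← fittingIdeal_prod (X := X) K']
  -- Both modules become quotients of the same free module on `X ⊕ Y`, by shears. The two kernels
  -- are `x + T' y ∈ K` and `y + T x ∈ K'`, and they coincide because `T` and `T'` are inverse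
  -- modulo `K` and `K'`.
  let e : ((X → R) × (Y → R)) ≃ₗ[R] ((X → R) × (Y → R)) :=
    { toFun := fun p => (p.1 - T' p.2, p.2)
      invFun := fun p => (p.1 + T' p.2, p.2)
      map_add' := fun p p' => by
        ext <;> simp; ring
      map_smul' := fun c p => by
        ext <;> simp; ring
      left_inv := fun p => by simp
      right_inv := fun p => by simp }
  let e' : ((Y → R) × (X → R)) ≃ₗ[R] ((X → R) × (Y → R)) :=
    { toFun := fun p => (p.2, p.1 - T p.2)
      invFun := fun p => (p.2 + T p.1, p.1)
      map_add' := fun p p' => by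
        ext <;> simp; ring
      map_smul' := fun c p => by
        ext <;> simp; ring
      left_inv := fun p => by simp
      right_inv := fun p => by simp }
  have hX := Fintype.card_pos (α := X)
  have hY := Fintype.card_pos (α := Y)
  rw [show Fintype.card Y - 1 + Fintype.card X = Fintype.card X - 1 + Fintype.card Y by omega,
    ← fittingIdeal_map_equiv _ e, ← fittingIdeal_map_equiv _ e']
  congr 1
  ext ⟨x, y⟩
  rw [Submodule.mem_map_equiv, Submodule.mem_map_equiv]
  change (x + T' y ∈ K ∧ y ∈ ⊤) ↔ (y + T x ∈ K' ∧ x ∈ ⊤)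
  refine (and_iff_left trivial).trans (Iff.trans ?_ (and_iff_left trivial).symm)
  constructor
  · intro hx
    have := K'.sub_mem (hT _ hx) (h' y)
    rw [map_add] at this
    convert this using 1
    abel
  · intro hy
    have := K.sub_mem (hT' _ hy) (h x)
    rw [map_add] at this
    convert this using 1
    abel

end FittingIdeal

-- Fox calculus and independence of the presentation

section FoxCalculus

variable {X Y : Type} [DecidableEq X] [DecidableEq Y] {R : Type} [CommRing R]

/-- The vector of Fox derivatives, evaluated by a multiplicative map `β` to a ring. -/
noncomputable def foxVec (β : FreeGroup X →* R) (w : FreeGroup X) : X → R :=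
  fun j => MonoidAlgebra.lift ℤ R (FreeGroup X) β (foxDeriv j w)

theorem foxVec_of (β : FreeGroup X →* R) (i : X) :
    foxVec β (FreeGroup.of i) = Pi.single i 1 := by
  ext j
  by_cases h : i = j
  · subst h; simp [foxVec, foxDeriv_of]
  · simp [foxVec, foxDeriv_of, h, Ne.symm h]

theorem foxVec_mul (β : FreeGroup X →* R) (u v : FreeGroup X) :
    foxVec β (u * v) = foxVec β u + β u • foxVec β v := by
  ext j
  simp [foxVec, foxDeriv_mul]

theorem foxVec_one (β : FreeGroup X →* R) : foxVec β 1 = 0 := by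
  have := foxVec_mul β 1 1
  simpa using this

theorem foxVec_inv (β : FreeGroup X →* R) (u : FreeGroup X) :
    foxVec β u⁻¹ = -(β u⁻¹ • foxVec β u) := by
  have := foxVec_mul β u⁻¹ u
  rw [inv_mul_cancel, foxVec_one] at this
  exact eq_neg_of_add_eq_zero_left this.symm

/-- A crossed homomorphism is determined by its values on the free generators. -/
theorem eq_comp_foxVec {V : Type*} [AddCommGroup V] [Module R V] (β : FreeGroup X →* R)
    (d : FreeGroup X → V) (hd : ∀ u v, d (u * v) = d u + β u • d v) (T : (X → R) →ₗ[R] V)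
    (hT : ∀ i, T (Pi.single i 1) = d (FreeGroup.of i)) (w : FreeGroup X) :
    d w = T (foxVec β w) := by
  have hd1 : d 1 = 0 := by simpa using hd 1 1
  induction w using FreeGroup.induction_on with
  | C1 => rw [foxVec_one, map_zero, hd1]
  | of i => rw [foxVec_of, hT]
  | inv_of i ih =>
    have := hd (FreeGroup.of i)⁻¹ (FreeGroup.of i)
    rw [inv_mul_cancel, hd1] at this
    rw [foxVec_inv, map_neg, map_smul, ← ih]
    exact eq_neg_of_add_eq_zero_left this.symm
  | mul u v hu hv => rw [hd, foxVec_mul, map_add, map_smul, hu, hv]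

/-- The fundamental formula of the Fox calculus. -/
theorem sum_foxVec_mul [Fintype X] (β : FreeGroup X →* R) (w : FreeGroup X) :
    ∑ j, foxVec β w j * (β (FreeGroup.of j) - 1) = β w - 1 := by
  have := eq_comp_foxVec β (fun w => β w - 1) (fun u v => by simp; ring)
    (Fintype.linearCombination R fun j => β (FreeGroup.of j) - 1)
    (fun i => by simp) w
  rw [this, Fintype.linearCombination_apply]
  simp

/-- The relation module of a normal subgroup `N` of a free group: the span of the Fox derivatives of
the elements of `N`. -/
noncomputable def relationModule (β : FreeGroup X →* R) (N : Subgroup (FreeGroup X)) :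
    Submodule R (X → R) :=
  Submodule.span R (foxVec β '' N)

/-- On words with `β w = 1` the Fox vector is additive, and conjugation by `g` multiplies it by `β
g`. So the words of this kind with Fox vector in the span form a normal subgroup. -/
theorem relationModule_normalClosure (β : FreeGroup X →* R) (S : Set (FreeGroup X))
    (hS : ∀ w ∈ S, β w = 1) :
    relationModule β (Subgroup.normalClosure S) = Submodule.span R (foxVec β '' S) := by
  refine le_antisymm (Submodule.span_le.2 ?_)
    (Submodule.span_mono (Set.image_mono Subgroup.subset_normalClosure))
  rintro _ ⟨w, hw, rfl⟩
  let N : Subgroup (FreeGroup X) :=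
    { carrier := {w | β w = 1 ∧ foxVec β w ∈ Submodule.span R (foxVec β '' S)}
      one_mem' := ⟨map_one β, by rw [foxVec_one]; exact Submodule.zero_mem _⟩
      mul_mem' := fun {u v} hu hv => ⟨by rw [map_mul, hu.1, hv.1, one_mul], by
        rw [foxVec_mul]
        exact Submodule.add_mem _ hu.2 (Submodule.smul_mem _ _ hv.2)⟩
      inv_mem' := fun {u} hu => ⟨by
        have := map_mul β u⁻¹ u
        rw [inv_mul_cancel, map_one, hu.1, mul_one] at this
        exact this.symm, by
        rw [foxVec_inv]
        exact Submodule.neg_mem _ (Submodule.smul_mem _ _ hu.2)⟩ }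
  have hN : N.Normal := ⟨fun u hu g => by
    have hg : β g * β g⁻¹ = 1 := by rw [← map_mul, mul_inv_cancel, map_one]
    refine ⟨by rw [map_mul, map_mul, hu.1, mul_one, hg], ?_⟩
    have : foxVec β (g * u * g⁻¹) = β g • foxVec β u := by
      rw [foxVec_mul, foxVec_mul, foxVec_inv, map_mul, hu.1, mul_one, smul_neg, smul_smul, hg,
        one_smul, add_neg_eq_iff_eq_add, add_comm]
    change _ ∈ Submodule.span R _
    rw [this]
    exact Submodule.smul_mem _ _ hu.2⟩
  have : Subgroup.normalClosure S ≤ N := Subgroup.normalClosure_le_normal fun w hw =>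
    ⟨hS w hw, Submodule.subset_span ⟨w, hw, rfl⟩⟩
  exact (this hw).2

variable {G : Type*} [Group G]

theorem foxVec_sub_mem (γ : G →* R) (ψ : FreeGroup X →* G) {u v : FreeGroup X} (h : ψ u = ψ v) :
    foxVec (γ.comp ψ) u - foxVec (γ.comp ψ) v ∈ relationModule (γ.comp ψ) ψ.ker := by
  have : foxVec (γ.comp ψ) (u * v⁻¹) = foxVec (γ.comp ψ) u - foxVec (γ.comp ψ) v := by
    have e : γ (ψ u) * γ (ψ v⁻¹) = 1 := by rw [← map_mul, h, map_inv, mul_inv_cancel, map_one]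
    rw [foxVec_mul, foxVec_inv, smul_neg, smul_smul, MonoidHom.comp_apply, MonoidHom.comp_apply, e,
      one_smul, sub_eq_add_neg]
  rw [← this]
  exact Submodule.subset_span ⟨_, by simp [h], rfl⟩

/-- A change of generators lifts to the free groups. The Fox vector of the lifted word is a crossed
homomorphism of the original word, hence linear in its Fox vector: `T` is the Jacobian of the
substitution. -/
theorem exists_foxVec_map (γ : G →* R) [Fintype X] (ψ : FreeGroup X →* G) (ψ' : FreeGroup Y →* G)
    (hψ' : Function.Surjective ψ') :
    ∃ (θ : FreeGroup X →* FreeGroup Y) (T : (X → R) →ₗ[R] (Y → R)), (∀ w, ψ' (θ w) = ψ w) ∧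
      ∀ w, foxVec (γ.comp ψ') (θ w) = T (foxVec (γ.comp ψ) w) := by
  choose f hf using fun x => hψ' (ψ (FreeGroup.of x))
  have h : ∀ w, ψ' (FreeGroup.lift f w) = ψ w := fun w => by
    rw [← MonoidHom.comp_apply]
    congr 1
    ext x
    simp [hf]
  refine ⟨FreeGroup.lift f,
    Fintype.linearCombination R fun x => foxVec (γ.comp ψ') (f x), h, ?_⟩
  refine eq_comp_foxVec (γ.comp ψ) (fun w => foxVec (γ.comp ψ') (FreeGroup.lift f w))
    (fun u v => ?_) _ fun i => by simp
  rw [map_mul, foxVec_mul, MonoidHom.comp_apply, MonoidHom.comp_apply, h]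

/-- The Fitting ideals of the relation modules do not depend on the presentation. -/
theorem fittingIdeal_relationModule (γ : G →* R) [Fintype X] [Fintype Y] [Nonempty X] [Nonempty Y]
    (ψ : FreeGroup X →* G) (ψ' : FreeGroup Y →* G) (hψ : Function.Surjective ψ)
    (hψ' : Function.Surjective ψ') :
    fittingIdeal (relationModule (γ.comp ψ) ψ.ker) (Fintype.card X - 1) =
      fittingIdeal (relationModule (γ.comp ψ') ψ'.ker) (Fintype.card Y - 1) := by
  obtain ⟨θ, T, hθ, hT⟩ := exists_foxVec_map γ ψ ψ' hψ'
  obtain ⟨θ', T', hθ', hT'⟩ := exists_foxVec_map γ ψ' ψ hψ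
  have hsub : ∀ {X Y : Type} [DecidableEq X] [DecidableEq Y] (ψ : FreeGroup X →* G)
      (ψ' : FreeGroup Y →* G) (θ : FreeGroup X →* FreeGroup Y) (T : (X → R) →ₗ[R] (Y → R)),
      (∀ w, ψ' (θ w) = ψ w) → (∀ w, foxVec (γ.comp ψ') (θ w) = T (foxVec (γ.comp ψ) w)) →
      ∀ x ∈ relationModule (γ.comp ψ) ψ.ker, T x ∈ relationModule (γ.comp ψ') ψ'.ker := by
    intro X Y _ _ ψ ψ' θ T hθ hT
    change _ ≤ (relationModule (γ.comp ψ') ψ'.ker).comap T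
    refine Submodule.span_le.2 ?_
    rintro _ ⟨w, hw, rfl⟩
    refine Submodule.subset_span ⟨θ w, ?_, hT w⟩
    simpa [hθ] using hw
  have hinv : ∀ {X Y : Type} [DecidableEq X] [DecidableEq Y] [Fintype X] (ψ : FreeGroup X →* G)
      (ψ' : FreeGroup Y →* G) (θ : FreeGroup X →* FreeGroup Y) (T : (X → R) →ₗ[R] (Y → R))
      (θ' : FreeGroup Y →* FreeGroup X) (T' : (Y → R) →ₗ[R] (X → R)),
      (∀ w, ψ' (θ w) = ψ w) → (∀ w, foxVec (γ.comp ψ') (θ w) = T (foxVec (γ.comp ψ) w)) →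
      (∀ w, ψ (θ' w) = ψ' w) → (∀ w, foxVec (γ.comp ψ) (θ' w) = T' (foxVec (γ.comp ψ') w)) →
      ∀ x, T' (T x) - x ∈ relationModule (γ.comp ψ) ψ.ker := by
    intro X Y _ _ _ ψ ψ' θ T θ' T' hθ hT hθ' hT' x
    rw [pi_eq_sum_univ' x]
    simp only [map_sum, map_smul, ← Finset.sum_sub_distrib, ← smul_sub]
    refine Submodule.sum_mem _ fun i _ => Submodule.smul_mem _ _ ?_
    -- A generator and its image under `θ' ∘ θ` agree in `G`, so their Fox vectors differ by an
    -- element of the relation module.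
    rw [← foxVec_of (γ.comp ψ), ← hT, ← hT']
    exact foxVec_sub_mem γ ψ (by rw [hθ', hθ])
  exact fittingIdeal_eq_of_inverse_mod T T' (hsub ψ ψ' θ T hθ hT) (hsub ψ' ψ θ' T' hθ' hT')
    (hinv ψ ψ' θ T θ' T' hθ hT hθ' hT') (hinv ψ' ψ θ' T' θ T hθ' hT' hθ hT)

theorem minorIdeal_eq_fittingIdeal {m n : ℕ} (M : Matrix (Fin m) (Fin n) R) (k : ℕ) :
    minorIdeal M k = fittingIdeal (Submodule.span R (Set.range M)) k := by
  refine le_antisymm (Ideal.span_le.2 ?_)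
    (fittingIdeal_span_le (Φ := Set.range fun j => LinearMap.proj (φ := fun _ => R) j) ?_ ?_)
  · rintro _ ⟨r, c, rfl⟩
    exact det_mem_fittingIdeal (K := Submodule.span R (Set.range M)) (κ := fun i => M (r i))
      (fun i => Submodule.subset_span ⟨r i, rfl⟩)
      fun j => LinearMap.proj (R := R) (φ := fun _ => R) (c j)
  · refine eq_top_iff.2 fun φ _ => ?_
    have : φ = ∑ j, φ (Pi.single j 1) • LinearMap.proj (φ := fun _ => R) j := by
      ext i
      simp [Pi.single_apply]
    rw [this]
    exact Submodule.sum_mem _ fun j _ =>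
      Submodule.smul_mem _ _ (Submodule.subset_span ⟨j, rfl⟩)
  · intro κ φ hκ hφ
    choose r hr using hκ
    choose c hc using hφ
    refine Ideal.subset_span ⟨r, c, congrArg _ ?_⟩
    ext i j
    simp [← hr, ← hc]

end FoxCalculus

-- Group relations at crossings and at triangles

section Colorings

variable {α H : Type} [Group H]

/-- The relations of the virtual knot group at a vertex whose arcs are labelled by elements of a
group. -/
def Node.Rel (s q : H) : Node H → Prop
  | .X .pos l r l' r' => r' = s * l * s⁻¹ ∧ l' = l * r * s * l⁻¹ * s⁻¹
  | .X .neg l r l' r' => l' = s⁻¹ * r * s ∧ r' = s⁻¹ * r⁻¹ * s * l * r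
  | .X .virt l r l' r' => r' = q * l * q⁻¹ ∧ l' = q⁻¹ * r * q
  | .pt a b => b = a

/-- The outgoing arc of the first strand at a crossing of sign `ε`, if passing it conjugates by
`z ^ ε`. -/
def conjSign (z : H) (ε : ℤˣ) (a : H) : H := if ε = 1 then z * a * z⁻¹ else z⁻¹ * a * z

/-- The outgoing under-arc at a classical crossing of sign `ε` with incoming over-arc `a` and incoming
under-arc `b`. -/
def underSign (s : H) (ε : ℤˣ) (a b : H) : H :=
  if ε = 1 then a * b * s * a⁻¹ * s⁻¹ else s⁻¹ * a⁻¹ * s * b * a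

/-- The outgoing arc of the second strand at a virtual crossing of sign `ε` with incoming arcs `a` and
`b` of the first and the second strand. -/
def virtSign (q : H) (ε : ℤˣ) (_a b : H) : H := conjSign q (-ε) b

theorem Node.rel_overUnder (s q : H) (ε : ℤˣ) (a b : H × H) :
    (Node.overUnder ε a b).Rel s q ↔
      a.2 = conjSign s ε a.1 ∧ b.2 = underSign s ε a.1 b.1 := by
  rcases Int.units_eq_one_or ε with rfl | rfl <;>
    simp [Node.overUnder, Node.Rel, conjSign, underSign]

theorem Node.rel_virtually (s q : H) (ε : ℤˣ) (a b : H × H) :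
    (Node.virtually ε a b).Rel s q ↔
      a.2 = conjSign q ε a.1 ∧ b.2 = virtSign q ε a.1 b.1 := by
  rcases Int.units_eq_one_or ε with rfl | rfl <;>
    simp [Node.virtually, Node.Rel, conjSign, virtSign, and_comm]

/-- The hypotheses isolate the common shape of all crossings: the first strand changes independently
of the second, and the second depends on both. The triangle system is therefore solved along `a`,
then `b`, then `c`. -/
theorem triangle_rel_iff {s q : H} {ab ac bc : ℤˣ → H × H → H × H → Node H}
    {f₁ f₂ f₃ : ℤˣ → H → H} {g₁ g₂ g₃ : ℤˣ → H → H → H}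
    (h₁ : ∀ ε a b, (ab ε a b).Rel s q ↔ a.2 = f₁ ε a.1 ∧ b.2 = g₁ ε a.1 b.1)
    (h₂ : ∀ ε a b, (ac ε a b).Rel s q ↔ a.2 = f₂ ε a.1 ∧ b.2 = g₂ ε a.1 b.1)
    (h₃ : ∀ ε a b, (bc ε a b).Rel s q ↔ a.2 = f₃ ε a.1 ∧ b.2 = g₃ ε a.1 b.1)
    (δ oa ob oc : ℤˣ) (a b c : Fin 3 → H) :
    (∀ N ∈ triangle ab ac bc δ oa ob oc a b c, N.Rel s q) ↔
      ((seg oa a).2 = f₁ (-(oa * ob * δ)) (seg oa a).1 ∧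
        (seg (-ob) b).2 = g₁ (-(oa * ob * δ)) (seg oa a).1 (seg (-ob) b).1) ∧
      ((seg (-oa) a).2 = f₂ (oa * oc * δ) (seg (-oa) a).1 ∧
        (seg oc c).2 = g₂ (oa * oc * δ) (seg (-oa) a).1 (seg oc c).1) ∧
      ((seg ob b).2 = f₃ (-(ob * oc * δ)) (seg ob b).1 ∧
        (seg (-oc) c).2 = g₃ (-(ob * oc * δ)) (seg ob b).1 (seg (-oc) c).1) := by
  simp [triangle, h₁, h₂, h₃]

theorem triangle_unique {s q : H} {ab ac bc : ℤˣ → H × H → H × H → Node H}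
    {f₁ f₂ f₃ : ℤˣ → H → H} {g₁ g₂ g₃ : ℤˣ → H → H → H}
    (h₁ : ∀ ε a b, (ab ε a b).Rel s q ↔ a.2 = f₁ ε a.1 ∧ b.2 = g₁ ε a.1 b.1)
    (h₂ : ∀ ε a b, (ac ε a b).Rel s q ↔ a.2 = f₂ ε a.1 ∧ b.2 = g₂ ε a.1 b.1)
    (h₃ : ∀ ε a b, (bc ε a b).Rel s q ↔ a.2 = f₃ ε a.1 ∧ b.2 = g₃ ε a.1 b.1)
    (δ oa ob oc : ℤˣ) (a b c a' b' c' : Fin 3 → H) (ha : a 0 = a' 0) (hb : b 0 = b' 0)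
    (hc : c 0 = c' 0) (h : ∀ N ∈ triangle ab ac bc δ oa ob oc a b c, N.Rel s q)
    (h' : ∀ N ∈ triangle ab ac bc δ oa ob oc a' b' c', N.Rel s q) :
    a 1 = a' 1 ∧ b 1 = b' 1 ∧ c 1 = c' 1 := by
  rw [triangle_rel_iff h₁ h₂ h₃] at h h'
  rcases Int.units_eq_one_or oa with rfl | rfl <;> rcases Int.units_eq_one_or ob with rfl | rfl <;>
    rcases Int.units_eq_one_or oc with rfl | rfl <;> simp [seg] at h h' <;> grind

/-- After the move the middle arcs are forced by the initial ones; `x`, `y`, `z` are these forced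
values. What remains, and is the content of `hyp`, is that the terminal arcs agree with those before
the move. -/
theorem triangle_exists {s q : H} {ab ac bc : ℤˣ → H × H → H × H → Node H}
    {f₁ f₂ f₃ : ℤˣ → H → H} {g₁ g₂ g₃ : ℤˣ → H → H → H}
    (h₁ : ∀ ε a b, (ab ε a b).Rel s q ↔ a.2 = f₁ ε a.1 ∧ b.2 = g₁ ε a.1 b.1)
    (h₂ : ∀ ε a b, (ac ε a b).Rel s q ↔ a.2 = f₂ ε a.1 ∧ b.2 = g₂ ε a.1 b.1)
    (h₃ : ∀ ε a b, (bc ε a b).Rel s q ↔ a.2 = f₃ ε a.1 ∧ b.2 = g₃ ε a.1 b.1)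
    (δ oa ob oc : ℤˣ)
    (hyp : ∀ a b c : Fin 3 → H,
      (∀ N ∈ triangle ab ac bc δ oa ob oc a b c, N.Rel s q) →
      ∀ x y z : H,
        (x = if oa = 1 then f₂ (oa * oc * δ) (a 0) else f₁ (-(oa * ob * δ)) (a 0)) →
        (y = if ob = 1 then g₁ (-(oa * ob * δ)) (if oa = 1 then x else a 0) (b 0) else
          f₃ (-(ob * oc * δ)) (b 0)) →
        (z = if oc = 1 then g₃ (-(ob * oc * δ)) (if ob = 1 then y else b 0) (c 0) else
          g₂ (oa * oc * δ) (if oa = 1 then a 0 else x) (c 0)) →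
        a 2 = (if oa = 1 then f₁ (-(oa * ob * δ)) x else f₂ (oa * oc * δ) x) ∧
        b 2 = (if ob = 1 then f₃ (-(ob * oc * δ)) y else
          g₁ (-(oa * ob * δ)) (if oa = 1 then x else a 0) y) ∧
        c 2 = (if oc = 1 then g₂ (oa * oc * δ) (if oa = 1 then a 0 else x) z else
          g₃ (-(ob * oc * δ)) (if ob = 1 then y else b 0) z))
    (a b c : Fin 3 → H)
    (h : ∀ N ∈ triangle ab ac bc δ oa ob oc a b c, N.Rel s q) :
    ∃ x y z : H, ∀ N ∈ triangle ab ac bc δ (-oa) (-ob) (-oc)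
      ![a 0, x, a 2] ![b 0, y, b 2] ![c 0, z, c 2], N.Rel s q := by
  have := hyp a b c h _ _ _ rfl rfl rfl
  revert this
  generalize hx : ite (oa = 1) (f₂ (oa * oc * δ) (a 0)) _ = x
  generalize hy : ite (ob = 1) (g₁ (-(oa * ob * δ)) (if oa = 1 then x else a 0) (b 0)) _ = y
  generalize hz : ite (oc = 1) (g₃ (-(ob * oc * δ)) (if ob = 1 then y else b 0) (c 0)) _ = z
  intro this
  refine ⟨x, y, z, ?_⟩
  rw [triangle_rel_iff h₁ h₂ h₃]
  rcases Int.units_eq_one_or oa with rfl | rfl <;>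
  rcases Int.units_eq_one_or ob with rfl | rfl <;>
  rcases Int.units_eq_one_or oc with rfl | rfl <;> simp [seg] at this hx hy hz ⊢ <;> grind

theorem units_neg_one_ne_one : ((-1 : ℤˣ) = 1) = False := by simp

theorem r3_rel {s q : H} (δ oa ob oc : ℤˣ) (a b c : Fin 3 → H)
    (h : ∀ N ∈ triangle Node.overUnder Node.overUnder Node.overUnder δ oa ob oc a b c, N.Rel s q) :
    ∃ x y z : H, ∀ N ∈ triangle Node.overUnder Node.overUnder Node.overUnder δ (-oa) (-ob) (-oc)
      ![a 0, x, a 2] ![b 0, y, b 2] ![c 0, z, c 2], N.Rel s q := by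
  refine triangle_exists (Node.rel_overUnder s q) (Node.rel_overUnder s q)
    (Node.rel_overUnder s q) δ oa ob oc ?_ a b c h
  clear h a b c
  intro a b c h x y z hx hy hz
  rw [triangle_rel_iff (Node.rel_overUnder s q) (Node.rel_overUnder s q)
    (Node.rel_overUnder s q)] at h
  revert h hx hy hz
  -- In each of the sixteen sign patterns all arcs are eliminated in favour of the three initial
  -- ones, which leaves identities between words.
  rcases Int.units_eq_one_or δ with rfl | rfl <;>
  rcases Int.units_eq_one_or oa with rfl | rfl <;>
  rcases Int.units_eq_one_or ob with rfl | rfl <;>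
  rcases Int.units_eq_one_or oc with rfl | rfl <;>
  simp only [seg, conjSign, underSign, neg_neg, mul_one, mul_neg,
    units_neg_one_ne_one, if_true, if_false] <;>
  generalize a 0 = a0, a 1 = a1, a 2 = a2, b 0 = b0, b 1 = b1, b 2 = b2, c 0 = c0, c 1 = c1,
    c 2 = c2 <;>
  rintro ⟨⟨h₁, h₂⟩, ⟨h₃, h₄⟩, h₅, h₆⟩ hx hy hz <;> subst_vars <;>
  simp [mul_assoc]

theorem v3_rel {s q : H} (δ oa ob oc : ℤˣ) (a b c : Fin 3 → H)
    (h : ∀ N ∈ triangle Node.virtually Node.virtually Node.virtually δ oa ob oc a b c, N.Rel s q) :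
    ∃ x y z : H, ∀ N ∈ triangle Node.virtually Node.virtually Node.virtually δ (-oa) (-ob) (-oc)
      ![a 0, x, a 2] ![b 0, y, b 2] ![c 0, z, c 2], N.Rel s q := by
  refine triangle_exists (Node.rel_virtually s q) (Node.rel_virtually s q)
    (Node.rel_virtually s q) δ oa ob oc ?_ a b c h
  clear h a b c
  intro a b c h x y z hx hy hz
  rw [triangle_rel_iff (Node.rel_virtually s q) (Node.rel_virtually s q)
    (Node.rel_virtually s q)] at h
  revert h hx hy hz
  rcases Int.units_eq_one_or δ with rfl | rfl <;>
  rcases Int.units_eq_one_or oa with rfl | rfl <;>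
  rcases Int.units_eq_one_or ob with rfl | rfl <;>
  rcases Int.units_eq_one_or oc with rfl | rfl <;>
  simp only [seg, conjSign, virtSign, neg_neg, mul_one, mul_neg,
    units_neg_one_ne_one, if_true, if_false] <;>
  generalize a 0 = a0, a 1 = a1, a 2 = a2, b 0 = b0, b 1 = b1, b 2 = b2, c 0 = c0, c 1 = c1,
    c 2 = c2 <;>
  rintro ⟨⟨h₁, h₂⟩, ⟨h₃, h₄⟩, h₅, h₆⟩ hx hy hz <;> subst_vars <;>
  simp [mul_assoc]

/-- The relations of a classical crossing are preserved when both strands are conjugated by `q`,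
because `q` commutes with `s`. This is the reason for the relation `[s, q] = 1`. -/
theorem v4_rel {s q : H} (hsq : s * q = q * s) (δ oa ob oc : ℤˣ) (a b c : Fin 3 → H)
    (h : ∀ N ∈ triangle Node.overUnder Node.virtually Node.virtually δ oa ob oc a b c, N.Rel s q) :
    ∃ x y z : H, ∀ N ∈ triangle Node.overUnder Node.virtually Node.virtually δ (-oa) (-ob) (-oc)
      ![a 0, x, a 2] ![b 0, y, b 2] ![c 0, z, c 2], N.Rel s q := by
  -- These rules move every power of `s` to the left of an adjacent power of `q`, which gives `simp`
  -- a normal form.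
  have e₁ : ∀ w, q * (s * w) = s * (q * w) := fun w => by rw [← mul_assoc, ← hsq, mul_assoc]
  have e₂ : ∀ w, q⁻¹ * (s⁻¹ * w) = s⁻¹ * (q⁻¹ * w) := fun w => by
    rw [← mul_assoc, ← mul_inv_rev, hsq, mul_inv_rev, mul_assoc]
  have e₃ : ∀ w, q * (s⁻¹ * w) = s⁻¹ * (q * w) := fun w => by
    rw [← mul_right_inj s, ← e₁, mul_inv_cancel_left, mul_inv_cancel_left]
  have e₄ : ∀ w, q⁻¹ * (s * w) = s * (q⁻¹ * w) := fun w => by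
    rw [← mul_right_inj q, e₁, mul_inv_cancel_left, mul_inv_cancel_left]
  have e₅ : q⁻¹ * s⁻¹ = s⁻¹ * q⁻¹ := by rw [← mul_inv_rev, hsq, mul_inv_rev]
  have e₆ : q * s⁻¹ = s⁻¹ * q := by simpa using e₃ 1
  have e₇ : q⁻¹ * s = s * q⁻¹ := by simpa using e₄ 1
  refine triangle_exists (Node.rel_overUnder s q) (Node.rel_virtually s q)
    (Node.rel_virtually s q) δ oa ob oc ?_ a b c h
  clear h a b c
  intro a b c h x y z hx hy hz
  rw [triangle_rel_iff (Node.rel_overUnder s q) (Node.rel_virtually s q)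
    (Node.rel_virtually s q)] at h
  revert h hx hy hz
  rcases Int.units_eq_one_or δ with rfl | rfl <;>
  rcases Int.units_eq_one_or oa with rfl | rfl <;>
  rcases Int.units_eq_one_or ob with rfl | rfl <;>
  rcases Int.units_eq_one_or oc with rfl | rfl <;>
  simp only [seg, conjSign, underSign, virtSign, neg_neg, mul_one, mul_neg,
    units_neg_one_ne_one, if_true, if_false] <;>
  generalize a 0 = a0, a 1 = a1, a 2 = a2, b 0 = b0, b 1 = b1, b 2 = b2, c 0 = c0, c 1 = c1,
    c 2 = c2 <;>
  rintro ⟨⟨h₁, h₂⟩, ⟨h₃, h₄⟩, h₅, h₆⟩ hx hy hz <;> subst_vars <;>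
  simp [mul_assoc, e₁, e₂, e₃, e₄, e₅, e₆, e₇, hsq.symm]

end Colorings
-- Transport of colorings through the moves that remove inner arcs
section Arcs

variable {α β H : Type}

/-- The arcs that end at a vertex of the list. -/
def inArcs (L : List (Node α)) : List α := L.flatMap Node.ins

/-- The arcs that begin at a vertex of the list. -/
def outArcs (L : List (Node α)) : List α := L.flatMap Node.outs

theorem Node.ins_map (f : α → β) (N : Node α) : (N.map f).ins = N.ins.map f := by
  cases N <;> rfl

theorem Node.outs_map (f : α → β) (N : Node α) : (N.map f).outs = N.outs.map f := by
  cases N <;> rfl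

theorem Node.map_map {γ : Type} (f : α → β) (g : β → γ) (N : Node α) :
    (N.map f).map g = N.map (g ∘ f) := by
  cases N <;> rfl

/-- The map `c` from arcs to a group satisfies the relations of the virtual knot group at all vertices
of the list. -/
def Colors [Group H] (s q : H) (c : α → H) (L : List (Node α)) : Prop :=
  ∀ N ∈ L, (N.map c).Rel s q

theorem colors_append [Group H] {s q : H} {c : α → H} {L L' : List (Node α)} :
    Colors s q c (L ++ L') ↔ Colors s q c L ∧ Colors s q c L' := by
  simp [Colors, or_imp, forall_and]

theorem colors_perm [Group H] {s q : H} {c : α → H} {L L' : List (Node α)} (h : L.Perm L') :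
    Colors s q c L ↔ Colors s q c L' :=
  forall_congr' fun _ => by rw [h.mem_iff]

theorem colors_map [Group H] {s q : H} {c : β → H} (f : α → β) {L : List (Node α)} :
    Colors s q c (L.map (Node.map f)) ↔ Colors s q (c ∘ f) L := by
  simp [Colors, Node.map_map]

theorem Node.map_eq_of_arcs {c c' : α → β} {N : Node α} (hi : ∀ i ∈ N.ins, c i = c' i)
    (ho : ∀ i ∈ N.outs, c i = c' i) : N.map c = N.map c' := by
  cases N <;> simp_all [Node.ins, Node.outs, Node.map]

theorem colors_congr [Group H] {s q : H} {c c' : α → H} {L : List (Node α)}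
    (hi : ∀ i ∈ inArcs L, c i = c' i) (ho : ∀ i ∈ outArcs L, c i = c' i) (h : Colors s q c L) :
    Colors s q c' L := by
  intro N hN
  rw [← Node.map_eq_of_arcs (fun i h => hi i (List.mem_flatMap.2 ⟨N, hN, h⟩))
    (fun i h => ho i (List.mem_flatMap.2 ⟨N, hN, h⟩))]
  exact h N hN

theorem inArcs_map (f : α → β) (L : List (Node α)) :
    inArcs (L.map (Node.map f)) = (inArcs L).map f := by
  simp [inArcs, List.flatMap_map, List.map_flatMap, Node.ins_map]

theorem outArcs_map (f : α → β) (L : List (Node α)) :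
    outArcs (L.map (Node.map f)) = (outArcs L).map f := by
  simp [outArcs, List.flatMap_map, List.map_flatMap, Node.outs_map]

/-- Every coloring of `A` becomes a coloring of `B` after a change of the values on `S`, and the values
on the arcs of `A` in `S` are determined by the values on the other arcs of `A`. -/
structure Interchange (S : Set ℕ) (A B : List (Node ℕ)) : Prop where
  extend : ∀ {H : Type} [Group H] {s q : H}, s * q = q * s → ∀ c : ℕ → H, Colors s q c A →
    ∃ c' : ℕ → H, Colors s q c' B ∧ ∀ i ∉ S, c' i = c i
  unique : ∀ {H : Type} [Group H] {s q : H} (c c' : ℕ → H), Colors s q c A → Colors s q c' A →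
    (∀ i, i ∈ inArcs A ∨ i ∈ outArcs A → i ∉ S → c i = c' i) → ∀ i ∈ inArcs A, i ∈ S → c i = c' i

theorem exists_update (c : ℕ → H) {x y z : ℕ} (hxy : x ≠ y) (hxz : x ≠ z) (hyz : y ≠ z)
    (u v w : H) :
    ∃ c' : ℕ → H, c' x = u ∧ c' y = v ∧ c' z = w ∧ ∀ i, i ≠ x → i ≠ y → i ≠ z → c' i = c i :=
  ⟨Function.update (Function.update (Function.update c x u) y v) z w, by simp [hxy, hxz],
    by simp [hyz], by simp, fun i hi hi' hi'' => by simp [hi, hi', hi'']⟩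

/-- `S` is a set of inner arcs of `A` and `B` that may be recolored when `A` is replaced by `B` or
vice versa. -/
structure Exchange (S : Set ℕ) (A B : List (Node ℕ)) : Prop where
  left : Interchange S A B
  right : Interchange S B A
  inner : ∀ i ∈ S, (i ∈ inArcs A ∧ i ∈ outArcs A) ∨ (i ∈ inArcs B ∧ i ∈ outArcs B)
  outer : ∀ i ∉ S, i ∈ inArcs A ↔ i ∈ inArcs B

open scoped Classical in
/-- The exchange property for a replacement that removes the inner arcs in `S`, whose values `V` are
determined by the values on the other arcs. -/
theorem exchange_of_removal {S : Set ℕ} {A B : List (Node ℕ)}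
    (V : ∀ {H : Type} [Group H], H → H → (ℕ → H) → ℕ → H)
    (hV : ∀ {H : Type} [Group H] (s q : H) (c c' : ℕ → H),
      (∀ i, i ∈ inArcs A ∨ i ∈ outArcs A → i ∉ S → c i = c' i) → V s q c = V s q c')
    (hcol : ∀ {H : Type} [Group H] (s q : H) (c : ℕ → H), Colors s q c A ↔
      (∀ i ∈ S, c i = V s q c i) ∧ Colors s q c B)
    (hS : ∀ i ∈ S, i ∈ inArcs A ∧ i ∈ outArcs A)
    (hin : ∀ i, i ∈ inArcs B ↔ i ∈ inArcs A ∧ i ∉ S)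
    (hout : ∀ i, i ∈ outArcs B ↔ i ∈ outArcs A ∧ i ∉ S) : Exchange S A B where
  left := ⟨fun _ c h => ⟨c, ((hcol _ _ c).1 h).2, fun _ _ => rfl⟩,
    fun c c' h h' hcc i _ hi => by
      rw [((hcol _ _ c).1 h).1 i hi, ((hcol _ _ c').1 h').1 i hi, hV _ _ c c' hcc]⟩
  right := ⟨fun {H _ s q} _ c h => by
      have hc' : ∀ i ∉ S, (if i ∈ S then V s q c i else c i) = c i := fun i hi => if_neg hi
      refine ⟨fun i => if i ∈ S then V s q c i else c i, (hcol _ _ _).2 ⟨fun i hi => ?_, ?_⟩, hc'⟩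
      · rw [hV s q _ c fun i _ hi => hc' i hi]
        exact if_pos hi
      · exact colors_congr (fun i hi => (hc' i ((hin i).1 hi).2).symm)
          (fun i hi => (hc' i ((hout i).1 hi).2).symm) h,
    fun _ _ _ _ _ i hi hi' => absurd hi' ((hin i).1 hi).2⟩
  inner i hi := Or.inl (hS i hi)
  outer i hi := by simp [hin, hi]

/-- In this form, as in `Node.rel_neg`, the second relation reads `l' * r' = l * r`: a classical
crossing preserves the product of the strands. This makes the checks for curls and bigons short. -/
theorem Node.rel_pos [Group H] {s q l r l' r' : H} : (Node.X .pos l r l' r').Rel s q ↔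
    r' = s * l * s⁻¹ ∧ l' = l * r * r'⁻¹ := by
  simp only [Node.Rel]
  refine and_congr_right fun h => ?_
  subst h
  simp [mul_assoc]

theorem Node.rel_neg [Group H] {s q l r l' r' : H} : (Node.X .neg l r l' r').Rel s q ↔
    l' = s⁻¹ * r * s ∧ r' = l'⁻¹ * l * r := by
  simp only [Node.Rel]
  refine and_congr_right fun h => ?_
  subst h
  simp [mul_assoc]

theorem Node.rel_virt [Group H] {s q l r l' r' : H} : (Node.X .virt l r l' r').Rel s q ↔
    r' = q * l * q⁻¹ ∧ l' = q⁻¹ * r * q := Iff.rfl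

theorem Node.rel_pt [Group H] {s q a b : H} : (Node.pt a b).Rel s q ↔ b = a := Iff.rfl

theorem exchange_rename : Exchange ∅ [] [] :=
  exchange_of_removal (fun _ _ _ _ => 1) (fun _ _ _ _ _ => rfl) (by simp) (by simp) (by simp)
    (by simp)

theorem exchange_pt_pt (a b c : ℕ) (hi : (inArcs [Node.pt a b, .pt b c]).Nodup)
    (ho : (outArcs [Node.pt a b, .pt b c]).Nodup) :
    Exchange {b} [Node.pt a b, .pt b c] [.pt a c] := by
  simp [inArcs, outArcs, Node.ins, Node.outs] at hi ho
  refine exchange_of_removal (fun _ _ f _ => f a) ?_ ?_ ?_ ?_ ?_ <;>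
    simp [inArcs, outArcs, Node.ins, Node.outs, Colors, Node.map, Node.rel_pt]
  all_goals grind

theorem exchange_pt_inl (k : Kind) (e l r l' r' : ℕ)
    (hi : (inArcs [Node.pt e l, .X k l r l' r']).Nodup)
    (ho : (outArcs [Node.pt e l, .X k l r l' r']).Nodup) :
    Exchange {l} [Node.pt e l, .X k l r l' r'] [.X k e r l' r'] := by
  simp [inArcs, outArcs, Node.ins, Node.outs] at hi ho
  refine exchange_of_removal (fun _ _ f _ => f e) ?_ ?_ ?_ ?_ ?_ <;>
    simp [inArcs, outArcs, Node.ins, Node.outs, Colors, Node.map, Node.rel_pt]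
  all_goals grind

theorem exchange_pt_inr (k : Kind) (e l r l' r' : ℕ)
    (hi : (inArcs [Node.pt e r, .X k l r l' r']).Nodup)
    (ho : (outArcs [Node.pt e r, .X k l r l' r']).Nodup) :
    Exchange {r} [Node.pt e r, .X k l r l' r'] [.X k l e l' r'] := by
  simp [inArcs, outArcs, Node.ins, Node.outs] at hi ho
  refine exchange_of_removal (fun _ _ f _ => f e) ?_ ?_ ?_ ?_ ?_ <;>
    simp [inArcs, outArcs, Node.ins, Node.outs, Colors, Node.map, Node.rel_pt]
  all_goals grind

theorem exchange_pt_outl (k : Kind) (e l r l' r' : ℕ)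
    (hi : (inArcs [Node.pt l' e, .X k l r l' r']).Nodup)
    (ho : (outArcs [Node.pt l' e, .X k l r l' r']).Nodup) :
    Exchange {l'} [Node.pt l' e, .X k l r l' r'] [.X k l r e r'] := by
  simp [inArcs, outArcs, Node.ins, Node.outs] at hi ho
  refine exchange_of_removal (fun _ _ f _ => f e) ?_ ?_ ?_ ?_ ?_ <;>
    simp [inArcs, outArcs, Node.ins, Node.outs, Colors, Node.map, Node.rel_pt]
  all_goals grind

theorem exchange_pt_outr (k : Kind) (e l r l' r' : ℕ)
    (hi : (inArcs [Node.pt r' e, .X k l r l' r']).Nodup)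
    (ho : (outArcs [Node.pt r' e, .X k l r l' r']).Nodup) :
    Exchange {r'} [Node.pt r' e, .X k l r l' r'] [.X k l r l' e] := by
  simp [inArcs, outArcs, Node.ins, Node.outs] at hi ho
  refine exchange_of_removal (fun _ _ f _ => f e) ?_ ?_ ?_ ?_ ?_ <;>
    simp [inArcs, outArcs, Node.ins, Node.outs, Colors, Node.map, Node.rel_pt]
  all_goals grind

/-- The generator by which a crossing of the given kind conjugates. -/
def Kind.conj (s q : H) : Kind → H
  | .virt => q
  | _ => s

/-- For a classical curl the preserved product is `x * b = x * a`, so `b = a`; for a virtual one the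
conjugations by `q` and `q⁻¹` cancel. -/
theorem rel_curl_left [Group H] (s q : H) (k : Kind) (a b x : H) :
    (Node.X k x a x b).Rel s q ↔ x = (k.conj s q)⁻¹ * b * k.conj s q ∧ b = a := by
  cases k
  · rw [Node.rel_pos]
    constructor
    · rintro ⟨h₁, h₂⟩
      rw [mul_assoc, left_eq_mul, mul_inv_eq_one] at h₂
      simp [h₁, h₂, mul_assoc, Kind.conj]
    · rintro ⟨rfl, rfl⟩
      simp [mul_assoc, Kind.conj]
  · rw [Node.rel_neg]
    constructor
    · rintro ⟨h₁, h₂⟩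
      simp_all [mul_assoc, Kind.conj, eq_comm]
    · rintro ⟨rfl, rfl⟩
      simp [mul_assoc, Kind.conj]
  · rw [Node.rel_virt]
    constructor
    · rintro ⟨h₁, h₂⟩
      simp_all [mul_assoc, Kind.conj, eq_comm]
    · rintro ⟨rfl, rfl⟩
      simp [mul_assoc, Kind.conj]

theorem exchange_curl_left (k : Kind) (a b x : ℕ) (hi : (inArcs [Node.X k x a x b]).Nodup)
    (ho : (outArcs [Node.X k x a x b]).Nodup) :
    Exchange {x} [Node.X k x a x b] [.pt a b] := by
  simp [inArcs, outArcs, Node.ins, Node.outs] at hi ho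
  refine exchange_of_removal (fun s q f _ => (k.conj s q)⁻¹ * f b * k.conj s q) ?_ ?_ ?_ ?_ ?_ <;>
    simp [inArcs, outArcs, Node.ins, Node.outs, Colors, Node.map, Node.rel_pt,
      rel_curl_left]
  all_goals grind

theorem rel_curl_right [Group H] (s q : H) (k : Kind) (a b x : H) :
    (Node.X k a x b x).Rel s q ↔ x = k.conj s q * b * (k.conj s q)⁻¹ ∧ b = a := by
  cases k
  · rw [Node.rel_pos]
    constructor
    · rintro ⟨h₁, h₂⟩
      simp_all [mul_assoc, Kind.conj, eq_comm]
    · rintro ⟨rfl, rfl⟩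
      simp [mul_assoc, Kind.conj]
  · rw [Node.rel_neg]
    constructor
    · rintro ⟨h₁, h₂⟩
      rw [right_eq_mul, inv_mul_eq_one] at h₂
      subst h₂
      simp [h₁, mul_assoc, Kind.conj]
    · rintro ⟨rfl, rfl⟩
      simp [mul_assoc, Kind.conj]
  · rw [Node.rel_virt]
    constructor
    · rintro ⟨h₁, h₂⟩
      simp_all [mul_assoc, Kind.conj, eq_comm]
    · rintro ⟨rfl, rfl⟩
      simp [mul_assoc, Kind.conj]

theorem exchange_curl_right (k : Kind) (a b x : ℕ) (hi : (inArcs [Node.X k a x b x]).Nodup)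
    (ho : (outArcs [Node.X k a x b x]).Nodup) :
    Exchange {x} [Node.X k a x b x] [.pt a b] := by
  simp [inArcs, outArcs, Node.ins, Node.outs] at hi ho
  refine exchange_of_removal (fun s q f _ => k.conj s q * f b * (k.conj s q)⁻¹) ?_ ?_ ?_ ?_ ?_ <;>
    simp [inArcs, outArcs, Node.ins, Node.outs, Colors, Node.map, Node.rel_pt,
      rel_curl_right]
  all_goals grind

/-- The values on the two inner arcs of a bigon. -/
def bigonValue [Group H] (s q a b : H) : Kind → H × H
  | .pos => (a * b * (s * a * s⁻¹)⁻¹, s * a * s⁻¹)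
  | .neg => (s⁻¹ * b * s, (s⁻¹ * b * s)⁻¹ * a * b)
  | .virt => (q⁻¹ * b * q, q * a * q⁻¹)

/-- As maps from incoming to outgoing pairs, a crossing and its mirror are inverse to each other. -/
theorem rel_bigon [Group H] (s q : H) (k : Kind) (a b x y c d : H) :
    (Node.X k a b x y).Rel s q ∧ (Node.X k.mirror x y c d).Rel s q ↔
      (x = (bigonValue s q a b k).1 ∧ y = (bigonValue s q a b k).2) ∧ c = a ∧ d = b := by
  cases k <;> simp only [Kind.mirror, Node.rel_pos, Node.rel_neg, Node.rel_virt] <;> constructor <;>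
    rintro ⟨⟨h₁, h₂⟩, h₃, h₄⟩ <;> simp_all [mul_assoc, bigonValue]

theorem exchange_bigon (k : Kind) (a b x y c d : ℕ)
    (hi : (inArcs [Node.X k a b x y, .X k.mirror x y c d]).Nodup)
    (ho : (outArcs [Node.X k a b x y, .X k.mirror x y c d]).Nodup) :
    Exchange {x, y} [Node.X k a b x y, .X k.mirror x y c d] [.pt a c, .pt b d] := by
  simp [inArcs, outArcs, Node.ins, Node.outs] at hi ho
  have hxy : y ≠ x := by grind
  refine exchange_of_removal (fun s q f i => if i = x then (bigonValue s q (f a) (f b) k).1 else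
    (bigonValue s q (f a) (f b) k).2) ?_ ?_ ?_ ?_ ?_ <;>
    simp [inArcs, outArcs, Node.ins, Node.outs, Colors, Node.map, Node.rel_pt,
      rel_bigon, hxy]
  all_goals grind

/-- The values on the two inner arcs of a bigon. -/
def bigonLeftValue [Group H] (s q a b : H) : Kind → H × H
  | .pos => (s⁻¹ * b * s * a * b⁻¹, s⁻¹ * b * s)
  | .neg => (s⁻¹ * a * s, s⁻¹ * a * s * b * a⁻¹)
  | .virt => (q⁻¹ * a * q, q⁻¹ * b * q)

/-- With antiparallel strands each crossing sees only one of `a` and `b`, so the inner arcs are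
found by solving the two crossings together. -/
theorem rel_bigonLeft [Group H] (s q : H) (k : Kind) (a b x y c d : H) :
    (Node.X k y a x d).Rel s q ∧ (Node.X k.mirror x b y c).Rel s q ↔
      (x = (bigonLeftValue s q a b k).1 ∧ y = (bigonLeftValue s q a b k).2) ∧ c = a ∧ d = b := by
  cases k <;> simp only [Kind.mirror, Node.rel_pos, Node.rel_neg, Node.rel_virt] <;> constructor <;>
    rintro ⟨⟨h₁, h₂⟩, h₃, h₄⟩ <;> simp_all [mul_assoc, bigonLeftValue]

theorem exchange_bigonLeft (k : Kind) (a b x y c d : ℕ)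
    (hi : (inArcs [Node.X k y a x d, .X k.mirror x b y c]).Nodup)
    (ho : (outArcs [Node.X k y a x d, .X k.mirror x b y c]).Nodup) :
    Exchange {x, y} [Node.X k y a x d, .X k.mirror x b y c] [.pt a c, .pt b d] := by
  simp [inArcs, outArcs, Node.ins, Node.outs] at hi ho
  have hxy : y ≠ x := by grind
  refine exchange_of_removal (fun s q f i => if i = x then (bigonLeftValue s q (f a) (f b) k).1 else
    (bigonLeftValue s q (f a) (f b) k).2) ?_ ?_ ?_ ?_ ?_ <;>
    simp [inArcs, outArcs, Node.ins, Node.outs, Colors, Node.map, Node.rel_pt,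
      rel_bigonLeft, hxy]
  all_goals grind

/-- The values on the two inner arcs of a bigon. -/
def bigonRightValue [Group H] (s q a b : H) : Kind → H × H
  | .pos => (s * a * s⁻¹, a⁻¹ * b * (s * a * s⁻¹))
  | .neg => (b⁻¹ * a * (s * b * s⁻¹), s * b * s⁻¹)
  | .virt => (q * a * q⁻¹, q * b * q⁻¹)

theorem rel_bigonRight [Group H] (s q : H) (k : Kind) (a b x y c d : H) :
    (Node.X k a y d x).Rel s q ∧ (Node.X k.mirror b x c y).Rel s q ↔
      (x = (bigonRightValue s q a b k).1 ∧ y = (bigonRightValue s q a b k).2) ∧ c = a ∧ d = b := by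
  cases k <;> simp only [Kind.mirror, Node.rel_pos, Node.rel_neg, Node.rel_virt] <;> constructor <;>
    rintro ⟨⟨h₁, h₂⟩, h₃, h₄⟩ <;> simp_all [mul_assoc, bigonRightValue]

theorem exchange_bigonRight (k : Kind) (a b x y c d : ℕ)
    (hi : (inArcs [Node.X k a y d x, .X k.mirror b x c y]).Nodup)
    (ho : (outArcs [Node.X k a y d x, .X k.mirror b x c y]).Nodup) :
    Exchange {x, y} [Node.X k a y d x, .X k.mirror b x c y] [.pt a c, .pt b d] := by
  simp [inArcs, outArcs, Node.ins, Node.outs] at hi ho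
  have hxy : y ≠ x := by grind
  refine exchange_of_removal (fun s q f i => if i = x then (bigonRightValue s q (f a) (f b) k).1 else
    (bigonRightValue s q (f a) (f b) k).2) ?_ ?_ ?_ ?_ ?_ <;>
    simp [inArcs, outArcs, Node.ins, Node.outs, Colors, Node.map, Node.rel_pt,
      rel_bigonRight, hxy]
  all_goals grind

end Arcs
-- Transport of colorings through the triangle moves
section Triangles

theorem seg_comp {α β : Type} (f : α → β) (o : ℤˣ) (a : Fin 3 → α) :
    (f (seg o a).1, f (seg o a).2) = seg o (f ∘ a) := by
  unfold seg
  split_ifs <;> rfl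

theorem triangle_map {α β : Type} (f : α → β) {ab ac bc : ℤˣ → α × α → α × α → Node α}
    {ab' ac' bc' : ℤˣ → β × β → β × β → Node β}
    (h₁ : ∀ ε a b, (ab ε a b).map f = ab' ε (f a.1, f a.2) (f b.1, f b.2))
    (h₂ : ∀ ε a b, (ac ε a b).map f = ac' ε (f a.1, f a.2) (f b.1, f b.2))
    (h₃ : ∀ ε a b, (bc ε a b).map f = bc' ε (f a.1, f a.2) (f b.1, f b.2))
    (δ oa ob oc : ℤˣ) (a b c : Fin 3 → α) :
    (triangle ab ac bc δ oa ob oc a b c).map (Node.map f) =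
      triangle ab' ac' bc' δ oa ob oc (f ∘ a) (f ∘ b) (f ∘ c) := by
  simp only [triangle, List.map_cons, List.map_nil, h₁, h₂, h₃, seg_comp]

theorem Node.overUnder_map {α β : Type} (f : α → β) (ε : ℤˣ) (a b : α × α) :
    (Node.overUnder ε a b).map f = Node.overUnder ε (f a.1, f a.2) (f b.1, f b.2) := by
  unfold Node.overUnder
  split_ifs <;> rfl

theorem Node.virtually_map {α β : Type} (f : α → β) (ε : ℤˣ) (a b : α × α) :
    (Node.virtually ε a b).map f = Node.virtually ε (f a.1, f a.2) (f b.1, f b.2) := by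
  unfold Node.virtually
  split_ifs <;> rfl

/-- A crossing of two strands `a.1 → a.2` and `b.1 → b.2`. -/
def IsCrossing {α : Type} (X : ℤˣ → α × α → α × α → Node α) : Prop :=
  ∀ ε a b, (X ε a b).ins.Perm [a.1, b.1] ∧ (X ε a b).outs.Perm [a.2, b.2]

theorem isCrossing_overUnder {α : Type} : IsCrossing (Node.overUnder (α := α)) := by
  intro ε a b
  unfold Node.overUnder
  split_ifs <;> simp [Node.ins, Node.outs, List.Perm.swap]

theorem isCrossing_virtually {α : Type} : IsCrossing (Node.virtually (α := α)) := by
  intro ε a b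
  unfold Node.virtually
  split_ifs <;> simp [Node.ins, Node.outs, List.Perm.swap]

/-- The list does not depend on the signs, so both sides of a triangle move have the same arcs. -/
theorem inArcs_triangle {α : Type} {ab ac bc : ℤˣ → α × α → α × α → Node α} (h₁ : IsCrossing ab)
    (h₂ : IsCrossing ac) (h₃ : IsCrossing bc) (δ oa ob oc : ℤˣ) (a b c : Fin 3 → α) :
    (inArcs (triangle ab ac bc δ oa ob oc a b c)).Perm [a 0, a 1, b 0, b 1, c 0, c 1] := by
  classical
  refine ((h₁ _ _ _).1.append ((h₂ _ _ _).1.append ((h₃ _ _ _).1.append List.Perm.nil))).trans ?_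
  rcases Int.units_eq_one_or oa with rfl | rfl <;>
  rcases Int.units_eq_one_or ob with rfl | rfl <;>
  rcases Int.units_eq_one_or oc with rfl | rfl <;>
  simp [seg, List.perm_iff_count, List.count_cons] <;> intros <;> ring

theorem outArcs_triangle {α : Type} {ab ac bc : ℤˣ → α × α → α × α → Node α} (h₁ : IsCrossing ab)
    (h₂ : IsCrossing ac) (h₃ : IsCrossing bc) (δ oa ob oc : ℤˣ) (a b c : Fin 3 → α) :
    (outArcs (triangle ab ac bc δ oa ob oc a b c)).Perm [a 1, a 2, b 1, b 2, c 1, c 2] := by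
  classical
  refine ((h₁ _ _ _).2.append ((h₂ _ _ _).2.append ((h₃ _ _ _).2.append List.Perm.nil))).trans ?_
  rcases Int.units_eq_one_or oa with rfl | rfl <;>
  rcases Int.units_eq_one_or ob with rfl | rfl <;>
  rcases Int.units_eq_one_or oc with rfl | rfl <;>
  simp [seg, List.perm_iff_count, List.count_cons] <;> intros <;> ring

/-- The exchange property of a move of triangles follows from the corresponding statements about
elements of groups. -/
theorem exchange_triangle {ab ac bc : ∀ α : Type, ℤˣ → α × α → α × α → Node α}
    (m₁ : ∀ (α β : Type) (f : α → β) ε a b,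
      (ab α ε a b).map f = ab β ε (f a.1, f a.2) (f b.1, f b.2))
    (m₂ : ∀ (α β : Type) (f : α → β) ε a b,
      (ac α ε a b).map f = ac β ε (f a.1, f a.2) (f b.1, f b.2))
    (m₃ : ∀ (α β : Type) (f : α → β) ε a b,
      (bc α ε a b).map f = bc β ε (f a.1, f a.2) (f b.1, f b.2))
    (h₁ : ∀ α, IsCrossing (ab α)) (h₂ : ∀ α, IsCrossing (ac α)) (h₃ : ∀ α, IsCrossing (bc α))
    (hext : ∀ (H : Type) [Group H] (s q : H), s * q = q * s → ∀ (δ oa ob oc : ℤˣ)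
      (a b c : Fin 3 → H),
      (∀ N ∈ triangle (ab H) (ac H) (bc H) δ oa ob oc a b c, N.Rel s q) →
      ∃ x y z : H, ∀ N ∈ triangle (ab H) (ac H) (bc H) δ (-oa) (-ob) (-oc)
        ![a 0, x, a 2] ![b 0, y, b 2] ![c 0, z, c 2], N.Rel s q)
    (huniq : ∀ (H : Type) [Group H] (s q : H) (δ oa ob oc : ℤˣ) (a b c a' b' c' : Fin 3 → H),
      a 0 = a' 0 → b 0 = b' 0 → c 0 = c' 0 →
      (∀ N ∈ triangle (ab H) (ac H) (bc H) δ oa ob oc a b c, N.Rel s q) →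
      (∀ N ∈ triangle (ab H) (ac H) (bc H) δ oa ob oc a' b' c', N.Rel s q) →
      a 1 = a' 1 ∧ b 1 = b' 1 ∧ c 1 = c' 1)
    (δ oa ob oc : ℤˣ) (a b c : Fin 3 → ℕ)
    (hi : (inArcs (triangle (ab ℕ) (ac ℕ) (bc ℕ) δ oa ob oc a b c)).Nodup)
    (ho : (outArcs (triangle (ab ℕ) (ac ℕ) (bc ℕ) δ oa ob oc a b c)).Nodup) :
    Exchange {a 1, b 1, c 1} (triangle (ab ℕ) (ac ℕ) (bc ℕ) δ oa ob oc a b c)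
      (triangle (ab ℕ) (ac ℕ) (bc ℕ) δ (-oa) (-ob) (-oc) a b c) := by
  have pin := fun δ oa ob oc => inArcs_triangle (h₁ ℕ) (h₂ ℕ) (h₃ ℕ) δ oa ob oc a b c
  have pout := fun δ oa ob oc => outArcs_triangle (h₁ ℕ) (h₂ ℕ) (h₃ ℕ) δ oa ob oc a b c
  rw [(pin _ _ _ _).nodup_iff] at hi
  rw [(pout _ _ _ _).nodup_iff] at ho
  simp at hi ho
  have hcol : ∀ {H : Type} [Group H] (s q : H) (f : ℕ → H) (δ oa ob oc : ℤˣ),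
      Colors s q f (triangle (ab ℕ) (ac ℕ) (bc ℕ) δ oa ob oc a b c) ↔
        ∀ N ∈ triangle (ab H) (ac H) (bc H) δ oa ob oc (f ∘ a) (f ∘ b) (f ∘ c), N.Rel s q := by
    intro H _ s q f δ oa ob oc
    rw [← triangle_map f (m₁ _ _ f) (m₂ _ _ f) (m₃ _ _ f)]
    simp [Colors]
  have key : ∀ oa ob oc : ℤˣ,
      Interchange {a 1, b 1, c 1} (triangle (ab ℕ) (ac ℕ) (bc ℕ) δ oa ob oc a b c)
        (triangle (ab ℕ) (ac ℕ) (bc ℕ) δ (-oa) (-ob) (-oc) a b c) := by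
    intro oa ob oc
    refine ⟨fun {H _ s q} hsq f hf => ?_, fun {H _ s q} f f' hf hf' hff i _ hi => ?_⟩
    · rw [hcol] at hf
      obtain ⟨x, y, z, hxyz⟩ := hext H s q hsq δ oa ob oc _ _ _ hf
      obtain ⟨f', hx, hy, hz, hf'⟩ := exists_update f (x := a 1) (y := b 1) (z := c 1)
        (by grind) (by grind) (by grind) x y z
      refine ⟨f', ?_, fun i hi => ?_⟩
      · rw [hcol]
        have ea : f' ∘ a = ![(f ∘ a) 0, x, (f ∘ a) 2] := by
          ext i
          fin_cases i
          exacts [hf' (a 0) (by grind) (by grind) (by grind), hx,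
            hf' (a 2) (by grind) (by grind) (by grind)]
        have eb : f' ∘ b = ![(f ∘ b) 0, y, (f ∘ b) 2] := by
          ext i
          fin_cases i
          exacts [hf' (b 0) (by grind) (by grind) (by grind), hy,
            hf' (b 2) (by grind) (by grind) (by grind)]
        have ec : f' ∘ c = ![(f ∘ c) 0, z, (f ∘ c) 2] := by
          ext i
          fin_cases i
          exacts [hf' (c 0) (by grind) (by grind) (by grind), hz,
            hf' (c 2) (by grind) (by grind) (by grind)]
        rwa [ea, eb, ec]
      · simp at hi
        exact hf' i hi.1 hi.2.1 hi.2.2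
    · rw [hcol] at hf hf'
      have hff' : ∀ i ∈ [a 0, a 1, b 0, b 1, c 0, c 1], i ∉ ({a 1, b 1, c 1} : Set ℕ) →
          f i = f' i := fun i h => hff i (Or.inl ((pin δ oa ob oc).mem_iff.2 h))
      obtain ⟨e₁, e₂, e₃⟩ := huniq H s q δ oa ob oc _ _ _ _ _ _
        (hff' (a 0) (by simp) (by simp; grind)) (hff' (b 0) (by simp) (by simp; grind))
        (hff' (c 0) (by simp) (by simp; grind)) hf hf'
      rcases hi with rfl | rfl | rfl
      exacts [e₁, e₂, e₃]
  refine ⟨key oa ob oc, ?_, fun i hi => Or.inl ?_, fun i _ => ?_⟩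
  -- The inverse of a triangle move is a triangle move with all three order signs reversed.
  · simpa using key (-oa) (-ob) (-oc)
  · rw [(pin _ _ _ _).mem_iff, (pout _ _ _ _).mem_iff]
    rcases hi with rfl | rfl | rfl <;> simp
  · rw [(pin _ _ _ _).mem_iff, (pin _ _ _ _).mem_iff]

theorem LocalMove.exists_exchange {A B : List (Node ℕ)} (h : LocalMove A B)
    (hi : (inArcs A).Nodup) (ho : (outArcs A).Nodup) : ∃ S : Set ℕ, Exchange S A B := by
  cases h with
  | rename => exact ⟨_, exchange_rename⟩
  | pt_pt a b c => exact ⟨_, exchange_pt_pt a b c hi ho⟩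
  | pt_inl k e l r l' r' => exact ⟨_, exchange_pt_inl k e l r l' r' hi ho⟩
  | pt_inr k e l r l' r' => exact ⟨_, exchange_pt_inr k e l r l' r' hi ho⟩
  | pt_outl k e l r l' r' => exact ⟨_, exchange_pt_outl k e l r l' r' hi ho⟩
  | pt_outr k e l r l' r' => exact ⟨_, exchange_pt_outr k e l r l' r' hi ho⟩
  | curl_left k a b x => exact ⟨_, exchange_curl_left k a b x hi ho⟩
  | curl_right k a b x => exact ⟨_, exchange_curl_right k a b x hi ho⟩
  | bigon k a b x y c d => exact ⟨_, exchange_bigon k a b x y c d hi ho⟩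
  | bigon_left k a b x y c d => exact ⟨_, exchange_bigonLeft k a b x y c d hi ho⟩
  | bigon_right k a b x y c d => exact ⟨_, exchange_bigonRight k a b x y c d hi ho⟩
  | r3 δ oa ob oc a b c =>
    exact ⟨_, exchange_triangle (fun _ _ => Node.overUnder_map) (fun _ _ => Node.overUnder_map)
      (fun _ _ => Node.overUnder_map) (fun _ => isCrossing_overUnder)
      (fun _ => isCrossing_overUnder) (fun _ => isCrossing_overUnder)
      (fun _ _ _ _ _ => r3_rel)
      (fun _ _ s q => triangle_unique (Node.rel_overUnder s q) (Node.rel_overUnder s q)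
        (Node.rel_overUnder s q)) δ oa ob oc a b c hi ho⟩
  | v3 δ oa ob oc a b c =>
    exact ⟨_, exchange_triangle (fun _ _ => Node.virtually_map) (fun _ _ => Node.virtually_map)
      (fun _ _ => Node.virtually_map) (fun _ => isCrossing_virtually)
      (fun _ => isCrossing_virtually) (fun _ => isCrossing_virtually)
      (fun _ _ _ _ _ => v3_rel)
      (fun _ _ s q => triangle_unique (Node.rel_virtually s q) (Node.rel_virtually s q)
        (Node.rel_virtually s q)) δ oa ob oc a b c hi ho⟩
  | v4 δ oa ob oc a b c =>
    exact ⟨_, exchange_triangle (fun _ _ => Node.overUnder_map) (fun _ _ => Node.virtually_map)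
      (fun _ _ => Node.virtually_map) (fun _ => isCrossing_overUnder)
      (fun _ => isCrossing_virtually) (fun _ => isCrossing_virtually)
      (fun _ _ _ _ hsq => v4_rel hsq)
      (fun _ _ s q => triangle_unique (Node.rel_overUnder s q) (Node.rel_virtually s q)
        (Node.rel_virtually s q)) δ oa ob oc a b c hi ho⟩

end Triangles
-- Invariance of the virtual knot group and its degree map
section Invariance

/-- The map from the generators of the virtual knot group to a group with given values. -/
def Gen.val {H : Type} {n : ℕ} (s q : H) (c : Fin n → H) : Gen n → H
  | .arc i => c i
  | .s => s
  | .q => q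

variable {H : Type} [Group H]

theorem Node.lift_relators {n : ℕ} (s q : H) (c : Fin n → H) (N : Node (Fin n)) :
    (∀ w ∈ N.relators, FreeGroup.lift (Gen.val s q c) w = 1) ↔ (N.map c).Rel s q := by
  rcases N with ⟨_ | _ | _, l, r, l', r'⟩ | ⟨a, b⟩ <;>
    simp [Node.relators, Node.map, Node.Rel, Gen.val, inv_mul_eq_one, mul_assoc]

namespace Diagram

/-- The element `s` of the virtual knot group. -/
def sElt (D : Diagram) : D.VG := PresentedGroup.of .s

/-- The element `q` of the virtual knot group. -/
def qElt (D : Diagram) : D.VG := PresentedGroup.of .q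

/-- The element of the virtual knot group given by an arc. -/
def arcElt (D : Diagram) (i : Fin D.n) : D.VG := PresentedGroup.of (.arc i)

theorem lift_val_eq_mk (D : Diagram) (w : FreeGroup (Gen D.n)) :
    FreeGroup.lift (Gen.val D.sElt D.qElt D.arcElt) w = PresentedGroup.mk D.relators w := by
  congr 1
  ext (i | _ | _) <;> simp [Gen.val, sElt, qElt, arcElt, PresentedGroup.of]

theorem colors_arcElt (D : Diagram) : Colors D.sElt D.qElt D.arcElt D.nodes := by
  intro N hN
  rw [← Node.lift_relators]
  intro w hw
  rw [lift_val_eq_mk]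
  exact PresentedGroup.one_of_mem (Or.inl ⟨N, hN, hw⟩)

theorem sElt_mul_qElt (D : Diagram) : D.sElt * D.qElt = D.qElt * D.sElt := by
  have := PresentedGroup.one_of_mem (rels := D.relators) (Or.inr rfl)
  rw [← lift_val_eq_mk] at this
  simpa [Gen.val, mul_inv_eq_one, mul_inv_eq_iff_eq_mul] using this

/-- The homomorphism from the virtual knot group given by a coloring of the arcs. -/
def homOfColors (D : Diagram) {s q : H} (hsq : s * q = q * s) {c : Fin D.n → H}
    (hc : Colors s q c D.nodes) : D.VG →* H :=
  PresentedGroup.toGroup (f := Gen.val s q c) (by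
    rintro w (⟨N, hN, hw⟩ | hw)
    · exact (Node.lift_relators s q c N).2 (hc N hN) w hw
    · rw [Set.mem_singleton_iff] at hw
      simp [hw, Gen.val, hsq])

section

variable (D : Diagram) {s q : H} (hsq : s * q = q * s) {c : Fin D.n → H}
  (hc : Colors s q c D.nodes)

theorem homOfColors_sElt : D.homOfColors hsq hc D.sElt = s := PresentedGroup.toGroup.of _

theorem homOfColors_qElt : D.homOfColors hsq hc D.qElt = q := PresentedGroup.toGroup.of _

theorem homOfColors_arcElt (i : Fin D.n) : D.homOfColors hsq hc (D.arcElt i) = c i :=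
  PresentedGroup.toGroup.of _

end

theorem hom_ext {D : Diagram} {φ ψ : D.VG →* H} (hs : φ D.sElt = ψ D.sElt)
    (hq : φ D.qElt = ψ D.qElt) (ha : ∀ i, φ (D.arcElt i) = ψ (D.arcElt i)) : φ = ψ := by
  refine PresentedGroup.ext fun x => ?_
  rcases x with i | _ | _
  exacts [ha i, hs, hq]

theorem degree_sElt (D : Diagram) : D.degree D.sElt = .ofAdd (1, 0, 0) :=
  PresentedGroup.toGroup.of _

theorem degree_qElt (D : Diagram) : D.degree D.qElt = .ofAdd (0, 0, 1) :=
  PresentedGroup.toGroup.of _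

theorem degree_arcElt (D : Diagram) (i : Fin D.n) : D.degree (D.arcElt i) = .ofAdd (0, 1, 0) :=
  PresentedGroup.toGroup.of _

end Diagram

theorem Node.Rel.map {H' : Type} [Group H'] (φ : H →* H') {s q : H} {N : Node H}
    (h : N.Rel s q) : (N.map φ).Rel (φ s) (φ q) := by
  rcases N with ⟨_ | _ | _, l, r, l', r'⟩ | ⟨a, b⟩ <;> simp_all [Node.Rel, Node.map]

theorem Colors.map {H' α : Type} [Group H'] (φ : H →* H') {s q : H} {c : α → H} {L : List (Node α)}
    (h : Colors s q c L) : Colors (φ s) (φ q) (φ ∘ c) L := by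
  intro N hN
  rw [← Node.map_map]
  exact (h N hN).map φ

theorem mem_arcs_iff {D : Diagram} {f : Fin D.n ↪ ℕ} {A rest : List (Node ℕ)}
    (h : (D.nodes.map (Node.map f)).Perm (A ++ rest)) (i : ℕ) :
    (i ∈ inArcs A ∨ i ∈ inArcs rest) ↔ ∃ j, f j = i := by
  have h' : (inArcs (D.nodes.map (Node.map f))).Perm (inArcs (A ++ rest)) := h.flatMap_right _
  rw [inArcs_map] at h'
  have h'' := (D.ins_perm.map f).symm.trans h'
  have := h''.mem_iff (a := i)
  simpa [inArcs] using this.symm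

theorem nodup_inArcs {D : Diagram} {f : Fin D.n ↪ ℕ} {A rest : List (Node ℕ)}
    (h : (D.nodes.map (Node.map f)).Perm (A ++ rest)) :
    (inArcs A ++ inArcs rest).Nodup := by
  have h' : (inArcs (D.nodes.map (Node.map f))).Perm (inArcs (A ++ rest)) := h.flatMap_right _
  rw [inArcs_map] at h'
  have h'' := ((D.ins_perm.map f).symm.trans h').nodup_iff.1
    ((List.nodup_finRange _).map f.injective)
  simpa [inArcs] using h''

theorem nodup_outArcs {D : Diagram} {f : Fin D.n ↪ ℕ} {A rest : List (Node ℕ)}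
    (h : (D.nodes.map (Node.map f)).Perm (A ++ rest)) :
    (outArcs A ++ outArcs rest).Nodup := by
  have h' : (outArcs (D.nodes.map (Node.map f))).Perm (outArcs (A ++ rest)) := h.flatMap_right _
  rw [outArcs_map] at h'
  have h'' := ((D.outs_perm.map f).symm.trans h').nodup_iff.1
    ((List.nodup_finRange _).map f.injective)
  simpa [outArcs] using h''

theorem mem_outArcs {D : Diagram} {f : Fin D.n ↪ ℕ} {A rest : List (Node ℕ)}
    (h : (D.nodes.map (Node.map f)).Perm (A ++ rest)) {i : ℕ} (hi : i ∈ outArcs A) :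
    ∃ j, f j = i := by
  have h' : (outArcs (D.nodes.map (Node.map f))).Perm (outArcs (A ++ rest)) := h.flatMap_right _
  rw [outArcs_map] at h'
  have h'' := (D.outs_perm.map f).symm.trans h'
  have := h''.mem_iff (a := i)
  simp only [List.mem_map, List.mem_finRange, true_and] at this
  exact this.2 (by simpa [outArcs] using Or.inl hi)

theorem colors_extend_iff {D : Diagram} {f : Fin D.n ↪ ℕ} {A rest : List (Node ℕ)}
    (h : (D.nodes.map (Node.map f)).Perm (A ++ rest)) {s q : H} (c : ℕ → H) :
    Colors s q (c ∘ f) D.nodes ↔ Colors s q c A ∧ Colors s q c rest := by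
  rw [← colors_map, colors_perm h, colors_append]

/-- Two homomorphisms give two colorings of `A`. If these agree off `S`, the uniqueness in
`Interchange` makes them agree on `S`. So the arcs outside `S`, with `s` and `q`, already determine
a homomorphism. -/
theorem hom_ext_of_interchange {D : Diagram} {f : Fin D.n ↪ ℕ} {A B rest : List (Node ℕ)}
    (h : (D.nodes.map (Node.map f)).Perm (A ++ rest)) {S : Set ℕ} (hI : Interchange S A B)
    (hS : ∀ i ∈ S, i ∉ inArcs rest) {φ ψ : D.VG →* H} (hs : φ D.sElt = ψ D.sElt)
    (hq : φ D.qElt = ψ D.qElt) (ha : ∀ i, f i ∉ S → φ (D.arcElt i) = ψ (D.arcElt i)) : φ = ψ := by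
  refine Diagram.hom_ext hs hq fun i => ?_
  by_cases hi : f i ∈ S
  swap
  · exact ha i hi
  have hc : ∀ φ : D.VG →* H,
      Colors (φ D.sElt) (φ D.qElt) (Function.extend f (φ ∘ D.arcElt) 1) A := fun φ => by
    refine ((colors_extend_iff h _).1 ?_).1
    rw [Function.extend_comp f.injective]
    exact D.colors_arcElt.map φ
  have hφ := hc φ
  rw [hs, hq] at hφ
  have := hI.unique _ _ hφ (hc ψ) (fun k hk hkS => by
      obtain ⟨j, rfl⟩ : ∃ j, f j = k :=
        hk.elim (fun hk => (mem_arcs_iff h k).1 (Or.inl hk)) (mem_outArcs h)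
      rw [f.injective.extend_apply, f.injective.extend_apply]
      exact ha j hkS) (f i) (((mem_arcs_iff h _).2 ⟨i, rfl⟩).resolve_right (hS _ hi)) hi
  rwa [f.injective.extend_apply, f.injective.extend_apply] at this

/-- The group of `D` colors `D` tautologically. Recoloring the arcs in `S` gives a coloring of `D'`
in the same group, that is, a homomorphism. -/
theorem exists_hom_of_interchange {D D' : Diagram} {f : Fin D.n ↪ ℕ} {g : Fin D'.n ↪ ℕ}
    {A B rest : List (Node ℕ)} (h : (D.nodes.map (Node.map f)).Perm (A ++ rest))
    (h' : (D'.nodes.map (Node.map g)).Perm (B ++ rest)) {S : Set ℕ} (hI : Interchange S A B)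
    (hS : ∀ i ∈ S, i ∉ inArcs rest ∧ i ∉ outArcs rest) :
    ∃ F : D'.VG →* D.VG, F D'.sElt = D.sElt ∧ F D'.qElt = D.qElt ∧
      ∀ i j, g j = f i → g j ∉ S → F (D'.arcElt j) = D.arcElt i := by
  -- Labels that name no arc of `D` get the color `1`; they do not occur in `A` or `rest`.
  have hc : Colors D.sElt D.qElt (Function.extend f D.arcElt 1) A ∧
      Colors D.sElt D.qElt (Function.extend f D.arcElt 1) rest := by
    rw [← colors_extend_iff h, Function.extend_comp f.injective]
    exact D.colors_arcElt
  obtain ⟨c', hB, hc'⟩ := hI.extend D.sElt_mul_qElt _ hc.1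
  have hrest : Colors D.sElt D.qElt c' rest :=
    colors_congr (fun i hi => (hc' i fun hiS => (hS i hiS).1 hi).symm)
      (fun i hi => (hc' i fun hiS => (hS i hiS).2 hi).symm) hc.2
  refine ⟨D'.homOfColors D.sElt_mul_qElt ((colors_extend_iff h' c').2 ⟨hB, hrest⟩),
    D'.homOfColors_sElt _ _, D'.homOfColors_qElt _ _, fun i j hij hj => ?_⟩
  rw [D'.homOfColors_arcElt, Function.comp_apply, hc' _ hj, hij, f.injective.extend_apply]

theorem Diagram.Step.exists_mulEquiv {D D' : Diagram} (h : D.Step D') :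
    ∃ e : D.VG ≃* D'.VG, ∀ x, D'.degree (e x) = D.degree x := by
  obtain ⟨f, g, A, B, rest, hm, hA, hB⟩ := h
  have inA := nodup_inArcs hA
  have outA := nodup_outArcs hA
  have inB := nodup_inArcs hB
  have outB := nodup_outArcs hB
  obtain ⟨S, hE⟩ := hm.exists_exchange inA.of_append_left outA.of_append_left
  -- An arc begins once and ends once. An arc of `S` does both inside `A` or inside `B`, so the
  -- unchanged part never meets it.
  have hS : ∀ i ∈ S, i ∉ inArcs rest ∧ i ∉ outArcs rest := by
    intro i hi
    rcases hE.inner i hi with ⟨h₁, h₂⟩ | ⟨h₁, h₂⟩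
    · exact ⟨fun h => List.disjoint_of_nodup_append inA h₁ h,
        fun h => List.disjoint_of_nodup_append outA h₂ h⟩
    · exact ⟨fun h => List.disjoint_of_nodup_append inB h₁ h,
        fun h => List.disjoint_of_nodup_append outB h₂ h⟩
  have hfg : ∀ i, f i ∉ S → ∃ j, g j = f i := fun i hi =>
    (mem_arcs_iff hB _).1 (((mem_arcs_iff hA _).2 ⟨i, rfl⟩).imp_left (hE.outer _ hi).1)
  have hgf : ∀ j, g j ∉ S → ∃ i, f i = g j := fun j hj =>
    (mem_arcs_iff hA _).1 (((mem_arcs_iff hB _).2 ⟨j, rfl⟩).imp_left (hE.outer _ hj).2)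
  obtain ⟨F, hFs, hFq, hF⟩ := exists_hom_of_interchange hA hB hE.left hS
  obtain ⟨G, hGs, hGq, hG⟩ := exists_hom_of_interchange hB hA hE.right hS
  -- Both composites fix `s`, `q` and the arcs common to the two diagrams, which suffices by
  -- `hom_ext_of_interchange`.
  have hFG : F.comp G = MonoidHom.id _ :=
    hom_ext_of_interchange hA hE.left (fun i hi => (hS i hi).1) (by simp [hGs, hFs])
      (by simp [hGq, hFq]) fun i hi => by
        obtain ⟨j, hj⟩ := hfg i hi
        simp [hG j i hj.symm hi, hF i j hj (hj ▸ hi)]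
  have hGF : G.comp F = MonoidHom.id _ :=
    hom_ext_of_interchange hB hE.right (fun i hi => (hS i hi).1) (by simp [hGs, hFs])
      (by simp [hGq, hFq]) fun j hj => by
        obtain ⟨i, hi⟩ := hgf j hj
        simp [hF i j hi.symm hj, hG j i hi (hi ▸ hj)]
  have hdeg : D'.degree.comp G = D.degree :=
    hom_ext_of_interchange hA hE.left (fun i hi => (hS i hi).1)
      (by simp [hGs, Diagram.degree_sElt]) (by simp [hGq, Diagram.degree_qElt]) fun i hi => by
        obtain ⟨j, hj⟩ := hfg i hi
        simp [hG j i hj.symm hi, Diagram.degree_arcElt]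
  exact ⟨MonoidHom.toMulEquiv G F hFG hGF, fun x => DFunLike.congr_fun hdeg x⟩

/-- The virtual knot group and its homomorphism to `ℤ³` are invariants of virtual links. -/
theorem exists_mulEquiv_of_equivalent {D D' : Diagram} (h : Diagram.equivalence D D') :
    ∃ e : D.VG ≃* D'.VG, ∀ x, D'.degree (e x) = D.degree x := by
  induction (h : Relation.EqvGen Diagram.Step D D') with
  | rel D D' h => exact h.exists_mulEquiv
  | refl D => exact ⟨MulEquiv.refl _, fun _ => rfl⟩
  | symm D D' _ ih =>
    obtain ⟨e, he⟩ := ih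
    exact ⟨e.symm, fun x => by rw [← he, MulEquiv.apply_symm_apply]⟩
  | trans D D' D'' _ _ ih ih' =>
    obtain ⟨e, he⟩ := ih
    obtain ⟨e', he'⟩ := ih'
    exact ⟨e.trans e', fun x => by rw [MulEquiv.trans_apply, he', he]⟩

end Invariance
-- Bounds for the exponents of `q`
section Window

/-- The Laurent polynomials whose exponents of `q` lie between `a` and `b`. -/
def window (a b : ℤ) : AddSubgroup Laurent where
  carrier := {f | ∀ x ∈ f.coeff.support, a ≤ x.2.2 ∧ x.2.2 ≤ b}
  zero_mem' := by simp
  add_mem' {f g} hf hg x hx := by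
    rw [Finsupp.mem_support_iff, AddMonoidAlgebra.coeff_add, Finsupp.add_apply] at hx
    by_cases h : f.coeff x = 0
    · exact hg x (by simpa [h] using hx)
    · exact hf x (by simpa using h)
  neg_mem' {f} hf x hx := hf x (by simpa using hx)

theorem window_mono {a b a' b' : ℤ} (ha : a' ≤ a) (hb : b ≤ b') {f : Laurent}
    (hf : f ∈ window a b) : f ∈ window a' b' :=
  fun x hx => ⟨ha.trans (hf x hx).1, (hf x hx).2.trans hb⟩

theorem mul_mem_window {a b a' b' : ℤ} {f g : Laurent} (hf : f ∈ window a b)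
    (hg : g ∈ window a' b') : f * g ∈ window (a + a') (b + b') := by
  classical
  intro x hx
  obtain ⟨y, hy, z, hz, rfl⟩ := Finset.mem_add.1 (AddMonoidAlgebra.support_coeff_mul_subset f g hx)
  exact ⟨add_le_add (hf y hy).1 (hg z hz).1, add_le_add (hf y hy).2 (hg z hz).2⟩

theorem single_mem_window (x : ℤ × ℤ × ℤ) (r : ℤ) :
    (AddMonoidAlgebra.single x r : Laurent) ∈ window x.2.2 x.2.2 := by
  intro y hy
  rw [AddMonoidAlgebra.coeff_single] at hy
  have := Finsupp.support_single_subset hy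
  rw [Finset.mem_singleton] at this
  simp [this]

theorem prod_mem_window {ι : Type} (s : Finset ι) (f : ι → Laurent) (a b : ι → ℤ)
    (h : ∀ i ∈ s, f i ∈ window (a i) (b i)) :
    ∏ i ∈ s, f i ∈ window (∑ i ∈ s, a i) (∑ i ∈ s, b i) := by
  classical
  induction s using Finset.induction_on with
  | empty => exact single_mem_window 0 1
  | insert i s hi ih =>
    rw [Finset.prod_insert hi, Finset.sum_insert hi, Finset.sum_insert hi]
    exact mul_mem_window (h i (Finset.mem_insert_self i s))
      (ih fun j hj => h j (Finset.mem_insert_of_mem hj))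

theorem det_mem_window {ι : Type} [Fintype ι] [DecidableEq ι] (M : Matrix ι ι Laurent)
    (a b : ι → ℤ) (h : ∀ i j, M i j ∈ window (a i) (b i)) :
    M.det ∈ window (∑ i, a i) (∑ i, b i) := by
  -- After transposing, each term of the expansion is indexed by rows, so all terms share the same
  -- sum of row bounds.
  rw [← Matrix.det_transpose, Matrix.det_apply]
  refine AddSubgroup.sum_mem _ fun σ _ => ?_
  have := prod_mem_window Finset.univ (fun i => M i (σ i)) a b fun i _ => h i (σ i)
  rcases Int.units_eq_one_or (Equiv.Perm.sign σ) with hσ | hσ <;> rw [hσ]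
  · simpa using this
  · simpa using this

theorem qWidth_le {f : Laurent} {d : ℕ}
    (h : ∀ x ∈ f.coeff.support, ∀ y ∈ f.coeff.support, x.2.2 - y.2.2 ≤ d) : qWidth f ≤ d :=
  Finset.sup_le fun x hx => Finset.sup_le fun y hy => Int.toNat_le.2 (h x hx y hy)

/-- Extremal monomials of a product with respect to a linear order. -/
theorem exists_extremal {Γ : Type} [AddCommGroup Γ] [LinearOrder Γ] [IsOrderedAddMonoid Γ]
    (κ : ℤ × ℤ × ℤ → Γ) (hκ : Function.Injective κ) (hadd : ∀ x y, κ (x + y) = κ x + κ y)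
    {f g : Laurent} (hf : f ≠ 0) (hg : g ≠ 0) :
    ∃ x ∈ f.coeff.support, ∃ y ∈ g.coeff.support, x + y ∈ (f * g).coeff.support ∧
      (∀ z ∈ f.coeff.support, κ z ≤ κ x) ∧ ∀ z ∈ g.coeff.support, κ z ≤ κ y := by
  have ne : ∀ {f : Laurent}, f ≠ 0 → f.coeff.support.Nonempty := fun {f} hf => by
    rw [Finsupp.support_nonempty_iff]
    exact fun h => hf (AddMonoidAlgebra.ext h)
  obtain ⟨x, hx, hx'⟩ := Finset.exists_max_image f.coeff.support κ (ne hf)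
  obtain ⟨y, hy, hy'⟩ := Finset.exists_max_image g.coeff.support κ (ne hg)
  refine ⟨x, hx, y, hy, ?_, hx', hy'⟩
  -- The product of the two largest monomials arises in only one way, so its coefficient cannot
  -- cancel.
  have hU : UniqueAdd f.coeff.support g.coeff.support x y := by
    intro z w hz hw h
    have e : κ z + κ w = κ x + κ y := by rw [← hadd, h, hadd]
    have h₁ := hx' z hz
    have h₂ := hy' w hw
    have h₃ : κ z = κ x := by
      by_contra hne
      exact absurd e (add_lt_add_of_lt_of_le (lt_of_le_of_ne h₁ hne) h₂).ne
    exact ⟨hκ h₃, hκ (by rwa [h₃, add_right_inj] at e)⟩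
  rw [Finsupp.mem_support_iff, AddMonoidAlgebra.coeff_mul_add_of_uniqueAdd hU]
  exact mul_ne_zero (Finsupp.mem_support_iff.1 hx) (Finsupp.mem_support_iff.1 hy)

/-- The lexicographic order of monomials in which the exponent of `q` comes first. -/
def qKey (ε : ℤ) (x : ℤ × ℤ × ℤ) : ℤ ×ₗ ℤ ×ₗ ℤ := toLex (ε * x.2.2, toLex (x.1, x.2.1))

/-- The exponent of `q` alone does not separate monomials, hence the lexicographic refinement. The
signs `ε = 1` and `ε = -1` give the top and the bottom exponents. -/
theorem exists_extremal_q {ε : ℤ} (hε : ε ≠ 0) {f g : Laurent} (hf : f ≠ 0) (hg : g ≠ 0) :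
    ∃ x ∈ f.coeff.support, ∃ y ∈ g.coeff.support, x + y ∈ (f * g).coeff.support ∧
      (∀ z ∈ f.coeff.support, ε * z.2.2 ≤ ε * x.2.2) ∧
      ∀ z ∈ g.coeff.support, ε * z.2.2 ≤ ε * y.2.2 := by
  obtain ⟨x, hx, y, hy, hxy, h, h'⟩ := exists_extremal (qKey ε) (fun x y h => by
    simp only [qKey, toLex_inj, Prod.mk.injEq, mul_eq_mul_left_iff, hε, or_false] at h
    exact Prod.ext h.2.1 (Prod.ext h.2.2 h.1)) (fun x y => by
    simp only [qKey, ← toLex_add, Prod.mk_add_mk, Prod.fst_add, Prod.snd_add, mul_add]) hf hg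
  have hle : ∀ {z w}, qKey ε z ≤ qKey ε w → ε * z.2.2 ≤ ε * w.2.2 := fun h =>
    (Prod.Lex.toLex_le_toLex.1 h).elim le_of_lt fun h => h.1.le
  exact ⟨x, hx, y, hy, hxy, fun z hz => hle (h z hz), fun z hz => hle (h' z hz)⟩

/-- Top and bottom exponents are additive under multiplication, and the cofactor has nonnegative
width. -/
theorem qWidth_le_of_dvd {f g : Laurent} (hfg : f ∣ g) (hg : g ≠ 0) {a b : ℤ} {d : ℕ}
    (hw : g ∈ window a b) (hd : b - a ≤ d) : qWidth f ≤ d := by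
  obtain ⟨c, rfl⟩ := hfg
  obtain ⟨x, -, y, hy, hxy, hx, -⟩ :=
    exists_extremal_q one_ne_zero (left_ne_zero_of_mul hg) (right_ne_zero_of_mul hg)
  obtain ⟨x', -, y', -, hxy', hx', hy'⟩ :=
    exists_extremal_q (neg_ne_zero.2 one_ne_zero) (left_ne_zero_of_mul hg)
      (right_ne_zero_of_mul hg)
  refine qWidth_le fun z hz w hw' => ?_
  have h₁ := (hw _ hxy).2
  have h₂ := (hw _ hxy').1
  have h₃ := hx z hz
  have h₄ := hx' w hw'
  have h₅ := hy' y hy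
  simp only [Prod.snd_add] at h₁ h₂
  linarith

-- Exponents of `q` in the Fox derivatives of the relators

section RelatorWindow

variable {X : Type} [DecidableEq X]

/-- The word `w` has degree `k` in `q`, and its Fox derivatives with respect to all generators except
`x₀` have exponents of `q` between `a` and `b`. -/
def FoxWindow (β : FreeGroup X →* Laurent) (x₀ : X) (w : FreeGroup X) (k a b : ℤ) : Prop :=
  (∃ x : ℤ × ℤ × ℤ, x.2.2 = k ∧ β w = AddMonoidAlgebra.single x 1) ∧
    ∀ j ≠ x₀, foxVec β w j ∈ window a b

variable {β : FreeGroup X →* Laurent} {x₀ : X}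

theorem FoxWindow.mul {u v : FreeGroup X} {k a b k' a' b' : ℤ} (hu : FoxWindow β x₀ u k a b)
    (hv : FoxWindow β x₀ v k' a' b') :
    FoxWindow β x₀ (u * v) (k + k') (min a (k + a')) (max b (k + b')) := by
  obtain ⟨⟨x, rfl, hx⟩, hu⟩ := hu
  obtain ⟨⟨y, rfl, hy⟩, hv⟩ := hv
  refine ⟨⟨x + y, rfl, by simp [hx, hy, AddMonoidAlgebra.single_mul_single]⟩, fun j hj => ?_⟩
  rw [foxVec_mul, hx]
  exact AddSubgroup.add_mem _ (window_mono (min_le_left _ _) (le_max_left _ _) (hu j hj))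
    (window_mono (min_le_right _ _) (le_max_right _ _)
      (mul_mem_window (single_mem_window x 1) (hv j hj)))

theorem FoxWindow.inv {u : FreeGroup X} {k a b : ℤ} (hu : FoxWindow β x₀ u k a b) :
    FoxWindow β x₀ u⁻¹ (-k) (-k + a) (-k + b) := by
  obtain ⟨⟨x, rfl, hx⟩, hu⟩ := hu
  have hinv : β u⁻¹ = AddMonoidAlgebra.single (-x) 1 := by
    have h : β u⁻¹ * β u = 1 := by rw [← map_mul, inv_mul_cancel, map_one]
    calc β u⁻¹ = β u⁻¹ * (β u * AddMonoidAlgebra.single (-x) 1) := by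
          rw [hx, AddMonoidAlgebra.single_mul_single, add_neg_cancel, mul_one,
            ← AddMonoidAlgebra.one_def, mul_one]
      _ = _ := by rw [← mul_assoc, h, one_mul]
  refine ⟨⟨-x, rfl, hinv⟩, fun j hj => ?_⟩
  rw [foxVec_inv, hinv]
  exact AddSubgroup.neg_mem _ (mul_mem_window (single_mem_window (-x) 1) (hu j hj))

theorem foxWindow_of {i : X} {x : ℤ × ℤ × ℤ}
    (h : β (FreeGroup.of i) = AddMonoidAlgebra.single x 1) :
    FoxWindow β x₀ (FreeGroup.of i) x.2.2 0 0 := by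
  refine ⟨⟨x, rfl, h⟩, fun j hj => ?_⟩
  rw [foxVec_of, Pi.single_apply]
  split_ifs
  · exact single_mem_window 0 1
  · exact AddSubgroup.zero_mem _

/-- The only nonzero derivative is in the omitted column, so the window may be placed anywhere. -/
theorem foxWindow_of_self {x : ℤ × ℤ × ℤ}
    (h : β (FreeGroup.of x₀) = AddMonoidAlgebra.single x 1) (a : ℤ) :
    FoxWindow β x₀ (FreeGroup.of x₀) x.2.2 a a := by
  refine ⟨⟨x, rfl, h⟩, fun j hj => ?_⟩
  rw [foxVec_of, Pi.single_eq_of_ne hj]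
  exact AddSubgroup.zero_mem _

/-- The Fox derivatives of `w` except the one with respect to `x₀` have `q`-width at most `d`. -/
def FoxWidth (β : FreeGroup X →* Laurent) (x₀ : X) (w : FreeGroup X) (d : ℕ) : Prop :=
  ∃ a : ℤ, ∀ j ≠ x₀, foxVec β w j ∈ window a (a + d)

theorem FoxWindow.foxWidth {w : FreeGroup X} {k a b : ℤ} (h : FoxWindow β x₀ w k a b) {d : ℕ}
    (hd : b ≤ a + d) : FoxWidth β x₀ w d :=
  ⟨a, fun j hj => window_mono le_rfl hd (h.2 j hj)⟩

end RelatorWindow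

section RelatorWidth

variable {n : ℕ} {β : FreeGroup (Gen n) →* Laurent}

/-- Only virtual crossings involve `q`. In each of their relators one strand is conjugated by `q` or
`q⁻¹`, which spreads the exponents over one step; two relators give the factor `2`. -/
theorem exists_foxWidth_relators
    (hβ : ∀ x, β (FreeGroup.of x) = AddMonoidAlgebra.single (Gen.degree x).toAdd 1)
    (N : Node (Fin n)) :
    ∃ ds : List ℕ, List.Forall₂ (FoxWidth β Gen.s) N.relators ds ∧
      ds.sum = 2 * N.isVirtual.toNat := by
  have x : ∀ i, FoxWindow β Gen.s (FreeGroup.of (Gen.arc i)) 0 0 0 := fun i => foxWindow_of (hβ _)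
  have s : FoxWindow β Gen.s (FreeGroup.of (Gen.s (n := n))) 0 0 0 := foxWindow_of (hβ _)
  have q : FoxWindow β Gen.s (FreeGroup.of (Gen.q (n := n))) 1 0 0 := foxWindow_of (hβ _)
  rcases N with ⟨_ | _ | _, l, r, l', r'⟩ | ⟨a, b⟩
  · refine ⟨[0, 0], ?_, rfl⟩
    simp only [Node.relators, List.forall₂_cons, List.forall₂_nil_left_iff, and_true]
    exact ⟨((x r').inv.mul ((s.mul (x l)).mul s.inv)).foxWidth (by simp),
      ((x l').inv.mul (((((x l).mul (x r)).mul s).mul (x l).inv).mul s.inv)).foxWidth (by simp)⟩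
  · refine ⟨[0, 0], ?_, rfl⟩
    simp only [Node.relators, List.forall₂_cons, List.forall₂_nil_left_iff, and_true]
    exact ⟨((x l').inv.mul ((s.inv.mul (x r)).mul s)).foxWidth (by simp),
      ((x r').inv.mul ((((s.inv.mul (x r).inv).mul s).mul (x l)).mul (x r))).foxWidth (by simp)⟩
  · refine ⟨[1, 1], ?_, rfl⟩
    simp only [Node.relators, List.forall₂_cons, List.forall₂_nil_left_iff, and_true]
    exact ⟨((x r').inv.mul ((q.mul (x l)).mul q.inv)).foxWidth (by simp),
      ((x l').inv.mul ((q.inv.mul (x r)).mul q)).foxWidth (by simp)⟩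
  · refine ⟨[0], ?_, rfl⟩
    simp only [Node.relators, List.forall₂_cons, List.forall₂_nil_left_iff, and_true]
    exact ((x b).inv.mul (x a)).foxWidth (by simp)

theorem exists_foxWidth_flatMap
    (hβ : ∀ x, β (FreeGroup.of x) = AddMonoidAlgebra.single (Gen.degree x).toAdd 1)
    (L : List (Node (Fin n))) :
    ∃ ds : List ℕ, List.Forall₂ (FoxWidth β Gen.s) (L.flatMap Node.relators) ds ∧
      ds.sum = 2 * L.countP Node.isVirtual := by
  induction L with
  | nil => exact ⟨[], by simp, rfl⟩
  | cons N L ih =>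
    obtain ⟨ds, h, hs⟩ := ih
    obtain ⟨ds', h', hs'⟩ := exists_foxWidth_relators hβ N
    refine ⟨ds' ++ ds, ?_, ?_⟩
    · rw [List.flatMap_cons]
      exact List.rel_append h' h
    · rw [List.sum_append, hs, hs', List.countP_cons]
      cases N.isVirtual
      · simp
      · simp
        ring

theorem foxWidth_commutator
    (hβ : ∀ x, β (FreeGroup.of x) = AddMonoidAlgebra.single (Gen.degree x).toAdd 1) :
    FoxWidth β Gen.s
    (.of .s * .of .q * (.of .s)⁻¹ * (.of .q)⁻¹ : FreeGroup (Gen n)) 0 := by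
  have s : ∀ a, FoxWindow β Gen.s (FreeGroup.of (Gen.s (n := n))) 0 a a := foxWindow_of_self (hβ _)
  have q : FoxWindow β Gen.s (FreeGroup.of (Gen.q (n := n))) 1 0 0 := foxWindow_of (hβ _)
  -- The window of the second `s` is put at `-1` to compensate for the degree `1` of the prefix `s *
  -- q`.
  exact ((((s 0).mul q).mul (s (-1)).inv).mul q.inv).foxWidth (by simp)

end RelatorWidth
end Window
-- The minor without the column of `s`, and the theorem
section Main

/-- The generators of the virtual knot group as a sum of finite types. -/
def Gen.equiv (n : ℕ) : Gen n ≃ Option (Option (Fin n)) where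
  toFun
    | .arc i => some (some i)
    | .s => none
    | .q => some none
  invFun
    | some (some i) => .arc i
    | none => .s
    | some none => .q
  left_inv x := by cases x <;> rfl
  right_inv x := by rcases x with _ | _ | _ <;> rfl

instance (n : ℕ) : Fintype (Gen n) := Fintype.ofEquiv _ (Gen.equiv n).symm

instance (n : ℕ) : Nonempty (Gen n) := ⟨.s⟩

theorem Gen.card (n : ℕ) : Fintype.card (Gen n) = n + 2 := by
  rw [Fintype.card_congr (Gen.equiv n)]
  simp

namespace Diagram

/-- The homomorphism `VG → ℤ³` as a map to Laurent polynomials. -/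
noncomputable def degreeMonomial (D : Diagram) : D.VG →* Laurent :=
  (AddMonoidAlgebra.of ℤ (ℤ × ℤ × ℤ)).comp D.degree

/-- The relation module of the standard presentation. -/
noncomputable def relMod (D : Diagram) : Submodule Laurent (Gen D.n → Laurent) :=
  relationModule (D.degreeMonomial.comp (PresentedGroup.mk D.relators))
    (PresentedGroup.mk D.relators).ker

theorem degreeMonomial_of (D : Diagram) (x : Gen D.n) :
    (D.degreeMonomial.comp (PresentedGroup.mk D.relators)) (FreeGroup.of x) =
      AddMonoidAlgebra.single (Gen.degree x).toAdd 1 := by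
  rw [MonoidHom.comp_apply, degreeMonomial, MonoidHom.comp_apply, AddMonoidAlgebra.of_apply]
  congr 2
  exact PresentedGroup.toGroup.of _

/-- The relators of the virtual knot group as a list. -/
def relatorList (D : Diagram) : List (FreeGroup (Gen D.n)) :=
  D.nodes.flatMap Node.relators ++ [.of .s * .of .q * (.of .s)⁻¹ * (.of .q)⁻¹]

theorem mem_relatorList (D : Diagram) (w : FreeGroup (Gen D.n)) :
    w ∈ D.relatorList ↔ w ∈ D.relators := by
  simp [relatorList, relators, or_comm]

/-- Each vertex has one relator per outgoing arc, and every arc begins at exactly one vertex. So the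
Fox matrix has one row fewer than columns. -/
theorem length_relatorList (D : Diagram) : D.relatorList.length = D.n + 1 := by
  have h : ∀ N : Node (Fin D.n), N.relators.length = N.outs.length := by
    rintro (⟨_ | _ | _, l, r, l', r'⟩ | ⟨a, b⟩) <;> rfl
  have := D.outs_perm.length_eq
  rw [List.length_finRange, List.length_flatMap] at this
  simp only [relatorList, List.length_append, List.length_flatMap, h, this, List.length_singleton]

end Diagram

theorem PresentedGroup.ker_mk {α : Type} (S : Set (FreeGroup α)) :
    (PresentedGroup.mk S).ker = Subgroup.normalClosure S :=
  QuotientGroup.ker_mk' _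

theorem PresentedGroup.mk_surjective {α : Type} (S : Set (FreeGroup α)) :
    Function.Surjective (PresentedGroup.mk S) :=
  QuotientGroup.mk'_surjective _

theorem Presentation.elementaryIdeal_eq {D D' : Diagram} (P : Presentation D)
    (e : D.VG ≃* D'.VG) (he : ∀ x, D'.degree (e x) = D.degree x) :
    P.elementaryIdeal = fittingIdeal D'.relMod (D'.n + 1) := by
  let ψ : FreeGroup (Fin P.g) →* D.VG :=
    P.iso.toMonoidHom.comp (PresentedGroup.mk (Set.range P.rel))
  let ψ' : FreeGroup (Gen D'.n) →* D.VG :=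
    e.symm.toMonoidHom.comp (PresentedGroup.mk D'.relators)
  have hψ : Function.Surjective ψ := P.iso.surjective.comp (PresentedGroup.mk_surjective _)
  have hψ' : Function.Surjective ψ' := e.symm.surjective.comp (PresentedGroup.mk_surjective _)
  have hker : ψ.ker = Subgroup.normalClosure (Set.range P.rel) := by
    rw [← PresentedGroup.ker_mk]
    ext w
    simp [ψ, MonoidHom.mem_ker]
  have hker' : ψ'.ker = (PresentedGroup.mk D'.relators).ker := by
    ext w
    simp [ψ', MonoidHom.mem_ker]
  have hcomp : D.degreeMonomial.comp ψ' =
      D'.degreeMonomial.comp (PresentedGroup.mk D'.relators) := by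
    refine MonoidHom.ext fun w => ?_
    simp [ψ', Diagram.degreeMonomial, ← he]
  -- Without generators the group would be trivial, yet `s` has nonzero degree. This keeps the
  -- subtraction in `P.g - 1` from truncating.
  have hg : Nonempty (Fin P.g) := by
    by_contra h
    rw [not_nonempty_iff] at h
    obtain ⟨w, hw⟩ := hψ D.sElt
    have := D.degree_sElt
    rw [← hw, Subsingleton.elim w 1, map_one, map_one] at this
    simpa using congrArg (fun x => x.toAdd.1) this
  have hrows : Set.range P.foxMatrix = foxVec (D.degreeMonomial.comp ψ) '' Set.range P.rel := by
    rw [← Set.range_comp]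
    rfl
  have h := fittingIdeal_relationModule D.degreeMonomial ψ ψ' hψ hψ'
  rw [hker', hcomp, hker, relationModule_normalClosure _ _ (fun w hw => by
    have : w ∈ ψ.ker := hker ▸ Subgroup.subset_normalClosure hw
    rw [MonoidHom.comp_apply, this, map_one]), ← hrows, Fintype.card_fin, Gen.card] at h
  rw [Presentation.elementaryIdeal, minorIdeal_eq_fittingIdeal, h]
  rfl

theorem Diagram.relMod_eq_span (D : Diagram) :
    D.relMod = Submodule.span Laurent (Set.range fun i : Fin D.relatorList.length =>
      foxVec (D.degreeMonomial.comp (PresentedGroup.mk D.relators)) (D.relatorList.get i)) := by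
  rw [relMod, PresentedGroup.ker_mk, relationModule_normalClosure _ _ fun w hw => by
    rw [MonoidHom.comp_apply, PresentedGroup.one_of_mem hw, map_one]]
  congr 1
  rw [Set.range_comp', Set.range_list_get]
  congr 1
  ext w
  exact (D.mem_relatorList w).symm

/-- The minor of the standard presentation that omits the column of `s` has small `q`-width, and the
elementary ideal vanishes if it does. -/
theorem Diagram.exists_minor (D : Diagram) : ∃ e ∈ fittingIdeal D.relMod (D.n + 1),
    (∃ a : ℤ, e ∈ window a (a + (2 * D.virtualCrossings : ℕ))) ∧
      (e = 0 → fittingIdeal D.relMod (D.n + 1) = ⊥) := by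
  set β := D.degreeMonomial.comp (PresentedGroup.mk D.relators) with hβ
  have hof := D.degreeMonomial_of
  rw [← hβ] at hof
  rw [D.relMod_eq_span, ← D.length_relatorList, ← hβ]
  set ρ : Fin D.relatorList.length → Gen D.n → Laurent := fun i => foxVec β (D.relatorList.get i)
    with hρ
  have hcard : Fintype.card (Fin D.relatorList.length) =
      Fintype.card {x : Gen D.n // x ≠ Gen.s} := by
    rw [Fintype.card_fin, length_relatorList, Fintype.card_subtype_compl, Gen.card,
      Fintype.card_subtype_eq]
    rfl
  -- Any ordering of the remaining columns will do; it affects only the sign of the minor.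
  let c := Fintype.equivOfCardEq hcard
  refine ⟨(Matrix.of fun i j => LinearMap.proj (R := Laurent) (φ := fun _ => Laurent) (c j).1
    (ρ i)).det, det_mem_fittingIdeal
    (K := Submodule.span Laurent (Set.range ρ)) (κ := ρ)
    (fun i => Submodule.subset_span ⟨i, rfl⟩) _, ?_, ?_⟩
  · obtain ⟨ds, hds, hsum⟩ := exists_foxWidth_flatMap hof D.nodes
    have hds' : List.Forall₂ (FoxWidth β Gen.s) D.relatorList (ds ++ [0]) :=
      List.rel_append hds (List.Forall₂.cons (foxWidth_commutator hof) List.Forall₂.nil)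
    have hlen := hds'.length_eq
    have hw : ∀ i : Fin D.relatorList.length, ∃ a : ℤ, ∀ j ≠ Gen.s,
        ρ i j ∈ window a (a + ((ds ++ [0]).get (Fin.cast hlen i) : ℕ)) := fun i =>
      hds'.get i.2 (hlen ▸ i.2)
    choose a ha using hw
    refine ⟨∑ i, a i, ?_⟩
    have := det_mem_window (Matrix.of fun i j => ρ i (c j).1) a _ fun i j => ha i _ (c j).2
    convert this using 1
    · rw [Finset.sum_add_distrib]
      congr 2
      rw [← Nat.cast_sum]
      congr 1
      have hcast : ∑ i, (ds ++ [0]).get (Fin.cast hlen i) = ∑ i, (ds ++ [0]).get i :=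
        Fintype.sum_equiv (finCongr hlen) _ _ fun i => rfl
      rw [hcast]
      simp only [List.get_eq_getElem, Fin.sum_univ_getElem]
      simp [hsum, virtualCrossings]
    · rfl
  · intro h0
    obtain ⟨v, hv, hv0⟩ := Matrix.exists_vecMul_eq_zero_iff.2 h0
    have hcol : ∀ j ≠ Gen.s, ∑ i, v i * ρ i j = 0 := fun j hj => by
      have := congrFun hv0 (c.symm ⟨j, hj⟩)
      simpa [Matrix.vecMul, dotProduct] using this
    -- This is the fundamental formula for a relator: the columns, weighted by `β x - 1`, sum to
    -- zero.
    have hrow : ∀ i, ∑ j, ρ i j * (β (FreeGroup.of j) - 1) = 0 := fun i => by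
      rw [hρ, sum_foxVec_mul, hβ, MonoidHom.comp_apply, PresentedGroup.one_of_mem
        ((D.mem_relatorList _).1 (List.get_mem _ _)), map_one, sub_self]
    have hs : β (FreeGroup.of Gen.s) - 1 ≠ 0 := by
      rw [hof, sub_ne_zero, AddMonoidAlgebra.one_def]
      intro h
      have := congrArg (fun f => f.coeff 0) h
      simp [AddMonoidAlgebra.coeff_single, Gen.degree] at this
    -- Combining the rows of the formula with coefficients `v` kills all columns except that of `s`;
    -- its nonzero factor `s - 1` cancels in the domain of Laurent polynomials.
    have hcol_s : ∑ i, v i * ρ i Gen.s = 0 := by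
      have h₁ : ∑ i, v i * ∑ j, ρ i j * (β (FreeGroup.of j) - 1) = 0 := by simp [hrow]
      simp_rw [Finset.mul_sum, ← mul_assoc] at h₁
      rw [Finset.sum_comm] at h₁
      simp_rw [← Finset.sum_mul] at h₁
      rw [Finset.sum_eq_single Gen.s (fun j _ hj => by rw [hcol j hj, zero_mul]) (by simp)] at h₁
      exact (mul_eq_zero.1 h₁).resolve_right hs
    have hv1 : ∑ i, v i • ρ i = 0 := by
      ext1 j
      rw [Finset.sum_apply, Pi.zero_apply]
      by_cases hj : j = Gen.s
      · rw [hj]; exact hcol_s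
      · exact hcol j hj
    refine eq_bot_iff.2 (fittingIdeal_span_le (Φ := Set.univ) Submodule.span_univ
      fun κ φ hκ _ => ?_)
    choose r hr using hκ
    rw [Ideal.mem_bot]
    -- There are as many chosen rows as relators. Either they are a permutation of all rows, which
    -- are dependent through `v`, or a row is repeated.
    by_cases hinj : Function.Injective r
    · have hbij := Finite.injective_iff_bijective.1 hinj
      refine Matrix.exists_vecMul_eq_zero_iff.1 ⟨v ∘ r, fun h => hv ?_, ?_⟩
      · ext1 i
        obtain ⟨k, rfl⟩ := hbij.2 i
        exact congrFun h k
      · ext1 j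
        simp only [Matrix.vecMul, dotProduct, Matrix.of_apply, Function.comp_apply, ← hr]
        rw [hbij.sum_comp fun i => v i * φ j (ρ i)]
        simp only [← smul_eq_mul, ← map_smul, ← map_sum, hv1, map_zero, Pi.zero_apply]
    · obtain ⟨i, i', hii, hne⟩ := Function.not_injective_iff.1 hinj
      exact Matrix.det_zero_of_row_eq hne (by ext1 j; simp [← hr, hii])

end Main
end VirtualKnot

open VirtualKnot in
theorem VirtualLink.exists_diagram_virtualCrossings (K : VirtualLink) :
    ∃ D : Diagram, D.Represents K ∧ D.virtualCrossings = K.virtualCrossingNumber := by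
  refine Nat.sInf_mem (s := {m | ∃ D : Diagram, D.Represents K ∧ D.virtualCrossings = m}) ?_
  obtain ⟨D, hD⟩ := Quotient.exists_rep K
  exact ⟨_, D, hD, rfl⟩

theorem mainTheorem7 (K : VirtualLink) (H : VirtualKnot.Laurent)
    (hH : K.IsVirtualAlexanderPolynomial H) :
    VirtualKnot.qWidth H ≤ 2 * K.virtualCrossingNumber := by
  obtain ⟨D, P, hD, ⟨-, hle⟩, hleast⟩ := hH
  obtain ⟨D', hD', hv⟩ := K.exists_diagram_virtualCrossings
  obtain ⟨φ, hφ⟩ := VirtualKnot.exists_mulEquiv_of_equivalent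
    (Quotient.exact (hD.trans hD'.symm))
  have hE := P.elementaryIdeal_eq φ hφ
  obtain ⟨e, he, ⟨a, ha⟩, h0⟩ := D'.exists_minor
  rw [← hE] at he h0
  rw [← hv]
  by_cases hz : e = 0
  -- When the elementary ideal is zero, the zero ideal is itself a principal ideal containing it, so
  -- minimality forces `H = 0`.
  · have : Ideal.span {H} ≤ ⊥ := hleast ⟨bot_isPrincipal, (h0 hz).le⟩
    have hH0 : H = 0 := by simpa using this
    simp [hH0, VirtualKnot.qWidth]
  · exact VirtualKnot.qWidth_le_of_dvd (Ideal.mem_span_singleton.1 (hle he)) hz ha (by simp)
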